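/- \textbf{Setting.} Let $\Gamma$ be (the vertex set of) a countable connected graph with graph distance $\mathrm{dist}$, and suppose that for some $d\in\mathbb N$ and $\kappa<\infty$ every ball of radius $r\ge 1$ has at most $\kappa r^d$ points. To each $x\in\Gamma$ associate a nonzero finite-dimensional Hilbert space $\mathcal H_x$ with $\sup_x\dim\mathcal H_x<\infty$. For finite $X\subset\Gamma$ let $\mathcal A^X=\mathcal B(\bigotimes_{x\in X}\mathcal H_x)$ with the operator norm; for $X\subset\Lambda$ regard $\mathcal A^X\cong\mathcal A^X\otimes 1\subset\mathcal A^\Lambda$. An \emph{interaction} is a family $\Phi=\{\Phi^\Lambda_s(X)\}$, indexed by finite sets $\Lambda,X\subset\Gamma$ and $s\in[0,1]$, of self-adjoint $\Phi^\Lambda_s(X)\in\mathcal A^X$ with $\Phi^\Lambda_s(X)=0$ unless $X\subset\Lambda$. Let $\mathcal S$ be the set of bounded, non-increasing functions $\zeta:[0,\infty)\to(0,\infty)$ with $\zeta(r+s)\ge\zeta(r)\zeta(s)$ and $\sup_r r^n\zeta(r)<\infty$ for all $n\in\mathbb N$. For such $\zeta$, $F_\zeta(r)=\zeta(r)(1+r)^{-(d+1)}$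 and $n\in\mathbb Z$ put $$\|\Phi\|_{\zeta,n}=\sup_{\Lambda}\ \sup_{x,y\in\Gamma}\ \sum_{Z\ni x,y}\ \sup_{s\in[0,1]}|Z|^n\,\frac{\|\Phi^\Lambda_s(Z)\|}{F_\zeta(\mathrm{dist}(x,y))}.$$ Let $\mathcal B_{\mathcal S,n}$ (resp. $\mathcal B_{\mathcal E,n}$) be the set of interactions with $\|\Phi\|_{\zeta,n}<\infty$ for some $\zeta\in\mathcal S$ (resp. for some $\zeta(r)=e^{-\mu r}$, $\mu>0$), and put $\mathcal B_{\mathcal S,\infty}=\bigcap_{n\in\mathbb N}\mathcal B_{\mathcal S,n}$, $\mathcal B_{\mathcal E,\infty}=\bigcap_{n\in\mathbb N}\mathcal B_{\mathcal E,n}$. Let $\mathcal L_{\mathcal S,n}$, $n\in\mathbb Z\cup\{\infty\}$, be the set of families $B=\{B^\Lambda_s\in\mathcal A^\Lambda\}$ of the form $B^\Lambda_s=\sum_{X\subset\Lambda}\Phi^\Lambda_s(X)$ with $\Phi\in\mathcal B_{\mathcal S,n}$. Let $m\ge1$ and let $H^\Lambda_s=\sum_{X\subset\Lambda}\Phi^\Lambda_s(X)$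 for an interaction $\Phi$ such that each $s\mapsto\Phi^\Lambda_s(X)$ is $d+m$ times continuously differentiable on $[0,1]$, the derivatives $\Phi^{(j)}$ belong to $\mathcal B_{\mathcal E,\infty}$ for $0\le j\le d+m$, and $\Phi^{(j)}_s(X)|_{s=0}=0$ for $1\le j\le d+m$. Let $\gamma>0$, and let $W_\gamma\in L^1(\mathbb R)$ be a real-valued function with $\sup_{|t|>1}|t|^n|W_\gamma(t)|<\infty$ for all $n\in\mathbb N$ and $$\widehat W_\gamma(\xi)=\frac1{\sqrt{2\pi}}\int_{\mathbb R}e^{-i\xi t}W_\gamma(t)\,dt=\frac{-i}{\sqrt{2\pi}\,\xi}\qquad\text{for } |\xi|\ge\gamma.$$ For a family $B=\{B^\Lambda_s\in\mathcal A^\Lambda\}$ define the family $\mathcal I(B)$ by $$\mathcal I(B)^\Lambda_s=\int_{\mathbb R}W_\gamma(t)\,e^{itH^\Lambda_s}B^\Lambda_s e^{-itH^\Lambda_s}\,dt .$$ \textbf{Lemma.} (i) For every $k\in\mathbb Z$, if $B\in\mathcal L_{\mathcal S,k+1}$, then $\mathcal I(B)\in\mathcal L_{\mathcal S,k}$; moreover,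 if $B\in\mathcal L_{\mathcal S,\infty}$, then $\mathcal I(B)\in\mathcal L_{\mathcal S,\infty}$. (ii) The generator of the spectral flow, $K=\mathcal I(\dot H)$ with $\dot H^\Lambda_s=\frac{d}{ds}H^\Lambda_s$, belongs to $\mathcal L_{\mathcal S,\infty}$. -/

import Mathlib

open scoped Matrix.Norms.L2Operator ENNReal

noncomputable section

namespace SpinSystem

/-! ## Observables

The Hilbert space at the site `x` is `ℂ ^ (q x)`, so that the Hilbert space of a finite set `X` of
sites, the tensor product over `x ∈ X`, is the space `ℓ²` over the configurations on `X`. -/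

section Observables

variable {Γ : Type*} [DecidableEq Γ] (q : Γ → ℕ)

/-- Configurations on `X`: the index set of the product basis of the tensor product of the
one-site spaces `ℂ ^ (q x)`, `x ∈ X`. -/
abbrev Config (X : Finset Γ) : Type _ := (x : X) → Fin (q x)

/-- The algebra of observables on `X`: all operators on the tensor product over `X`, written as
matrices in the product basis. The norm is the operator norm (that of the scope
`Matrix.Norms.L2Operator`), the star is the adjoint. -/
abbrev Obs (X : Finset Γ) : Type _ := Matrix (Config q X) (Config q X) ℂ

variable {q}

/-- The embedding `A ↦ A ⊗ 1` of the observables on `X` into those on `Y`, for `X ⊆ Y`. -/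
def embed {X Y : Finset Γ} (h : X ⊆ Y) (A : Obs q X) : Obs q Y := fun i j =>
  A (fun x => i ⟨x.1, h x.2⟩) (fun x => j ⟨x.1, h x.2⟩) *
    if ∀ y : Y, y.1 ∉ X → i y = j y then 1 else 0

end Observables

/-! ## Geometry and decay functions -/

/-- The graph `G` is `d`-dimensional: balls of radius `r ≥ 1` have at most `κ * r ^ d` points.
(The graph distance takes integer values, so integer radii suffice.) -/
def IsDimensional {Γ : Type*} (G : SimpleGraph Γ) (d : ℕ) : Prop :=
  ∃ κ : ℝ, ∀ y : Γ, ∀ r : ℕ, 1 ≤ r →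
    {x : Γ | G.dist x y ≤ r}.Finite ∧ ({x : Γ | G.dist x y ≤ r}.ncard : ℝ) ≤ κ * (r : ℝ) ^ d

/-- `F_ζ(r) = ζ(r) * (1 + r) ^ (-(d + 1))`. -/
def decay (d : ℕ) (ζ : ℝ → ℝ) (r : ℝ) : ℝ := ζ r * ((1 + r) ^ (d + 1))⁻¹

/-- The class `𝓢`: positive, bounded, non-increasing, logarithmically superadditive functions on
`[0, ∞)` that decay faster than any inverse power. The values at negative arguments are
irrelevant. -/
structure IsFastDecaying (ζ : ℝ → ℝ) : Prop where
  pos : ∀ r, 0 ≤ r → 0 < ζ r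
  bounded : BddAbove (ζ '' Set.Ici 0)
  antitone : AntitoneOn ζ (Set.Ici 0)
  superadditive : ∀ r s, 0 ≤ r → 0 ≤ s → ζ r * ζ s ≤ ζ (r + s)
  fast : ∀ n : ℕ, BddAbove ((fun r : ℝ => r ^ n * ζ r) '' Set.Ici 0)

/-! ## Interactions and local Hamiltonians -/

section Interactions

variable {Γ : Type*} [DecidableEq Γ] (q : Γ → ℕ)

/-- Candidates for a time-dependent and volume-dependent interaction: `Φ Λ s X` is the term of the
set `X` in the volume `Λ` at time `s`. Only times `s ∈ [0, 1]` matter. -/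
abbrev Terms : Type _ := (Λ : Finset Γ) → ℝ → (X : Finset Γ) → Obs q X

/-- Families of operators indexed by the finite volume `Λ` and the time `s`. Only times
`s ∈ [0, 1]` matter. -/
abbrev OpFamily : Type _ := (Λ : Finset Γ) → ℝ → Obs q Λ

variable {q}

/-- An interaction: all terms are self-adjoint and the term of `X` in `Λ` is zero unless
`X ⊆ Λ`. -/
structure IsInteraction (Φ : Terms q) : Prop where
  selfAdjoint : ∀ Λ, ∀ s ∈ Set.Icc (0 : ℝ) 1, ∀ X, IsSelfAdjoint (Φ Λ s X)
  eq_zero : ∀ Λ, ∀ s ∈ Set.Icc (0 : ℝ) 1, ∀ X, ¬ X ⊆ Λ → Φ Λ s X = 0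

/-- The norm `‖Φ‖_{ζ,n}`, with value `∞` allowed:
`sup_Λ sup_{x,y} ∑_{Z ∋ x,y} sup_s |Z|^n ‖Φ_s^Λ(Z)‖ / F_ζ(dist(x,y))`. -/
def interactionNorm (G : SimpleGraph Γ) (d : ℕ) (ζ : ℝ → ℝ) (n : ℤ) (Φ : Terms q) : ℝ≥0∞ :=
  ⨆ (Λ : Finset Γ) (x : Γ) (y : Γ), ∑' Z : {Z : Finset Γ // x ∈ Z ∧ y ∈ Z},
    ⨆ s ∈ Set.Icc (0 : ℝ) 1,
      ENNReal.ofReal (((Z.1.card : ℝ) ^ n * ‖Φ Λ s Z.1‖) / decay d ζ (G.dist x y))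

/-- `Φ ∈ 𝓑_{ζ,n}`. -/
def MemB (G : SimpleGraph Γ) (d : ℕ) (ζ : ℝ → ℝ) (n : ℤ) (Φ : Terms q) : Prop :=
  IsInteraction Φ ∧ interactionNorm G d ζ n Φ < ∞

/-- `Φ ∈ 𝓑_{𝓔,n}`: exponential decay. -/
def MemBE (G : SimpleGraph Γ) (d : ℕ) (n : ℤ) (Φ : Terms q) : Prop :=
  ∃ μ : ℝ, 0 < μ ∧ MemB G d (fun r => Real.exp (-μ * r)) n Φ

/-- `Φ ∈ 𝓑_{𝓢,n}`: decay faster than any inverse power. -/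
def MemBS (G : SimpleGraph Γ) (d : ℕ) (n : ℤ) (Φ : Terms q) : Prop :=
  ∃ ζ : ℝ → ℝ, IsFastDecaying ζ ∧ MemB G d ζ n Φ

/-- `Φ ∈ 𝓑_{𝓔,∞}`. -/
def MemBEInfty (G : SimpleGraph Γ) (d : ℕ) (Φ : Terms q) : Prop :=
  ∀ n : ℕ, MemBE G d (n : ℤ) Φ

/-- `Φ ∈ 𝓑_{𝓢,∞}`. -/
def MemBSInfty (G : SimpleGraph Γ) (d : ℕ) (Φ : Terms q) : Prop :=
  ∀ n : ℕ, MemBS G d (n : ℤ) Φ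

/-- The Hamiltonian of an interaction: `H_s^Λ = ∑_{X ⊆ Λ} Φ_s^Λ(X)`. -/
def hamiltonian (Φ : Terms q) : OpFamily q := fun Λ s =>
  ∑ X ∈ Λ.powerset.attach, embed (Finset.mem_powerset.1 X.2) (Φ Λ s X.1)

/-- `Φ` is an interaction associated to the family of operators `B`. -/
def IsAssociated (Φ : Terms q) (B : OpFamily q) : Prop :=
  ∀ Λ, ∀ s ∈ Set.Icc (0 : ℝ) 1, B Λ s = hamiltonian Φ Λ s

/-- `B ∈ 𝓛_{𝓢,n}`. -/
def MemLS (G : SimpleGraph Γ) (d : ℕ) (n : ℤ) (B : OpFamily q) : Prop :=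
  ∃ Φ : Terms q, MemBS G d n Φ ∧ IsAssociated Φ B

/-- `B ∈ 𝓛_{𝓢,∞}`. -/
def MemLSInfty (G : SimpleGraph Γ) (d : ℕ) (B : OpFamily q) : Prop :=
  ∃ Φ : Terms q, MemBSInfty G d Φ ∧ IsAssociated Φ B

/-- The `j`-th time derivative (on `[0, 1]`, one-sided at the end points) of the terms. -/
def timeDeriv (j : ℕ) (Φ : Terms q) : Terms q := fun Λ s X =>
  iteratedDerivWithin j (fun u => Φ Λ u X) (Set.Icc (0 : ℝ) 1) s

/-- Locality and differentiability of the driving: the terms are `d + m` times continuously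
differentiable on `[0, 1]`, the derivatives of order `0, …, d + m` are exponentially decaying
interactions, and those of order `1, …, d + m` vanish at time `0`. -/
structure IsSmoothLocal (G : SimpleGraph Γ) (d m : ℕ) (Φ : Terms q) : Prop where
  isInteraction : IsInteraction Φ
  contDiffOn : ∀ Λ X,
    ContDiffOn ℝ ((d + m : ℕ) : WithTop ℕ∞) (fun s => Φ Λ s X) (Set.Icc (0 : ℝ) 1)
  memB : ∀ j, j ≤ d + m → MemBEInfty G d (timeDeriv j Φ)
  deriv_zero : ∀ j, 1 ≤ j → j ≤ d + m → ∀ Λ X, timeDeriv j Φ Λ 0 X = 0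

end Interactions

/-! ## The dynamics, the map `𝓘` and the generator of the spectral flow -/

section Flow

/-- The weight functions `W_γ`: integrable, decaying faster than any inverse power, with
(unitary) Fourier transform `-i / (√(2π) ξ)` for `|ξ| ≥ γ`. -/
structure IsWeight (γ : ℝ) (W : ℝ → ℝ) : Prop where
  integrable : MeasureTheory.Integrable W
  fast : ∀ n : ℕ, BddAbove ((fun t : ℝ => |t| ^ n * |W t|) '' {t : ℝ | 1 < |t|})
  fourier : ∀ ξ : ℝ, γ ≤ |ξ| →
    ((Real.sqrt (2 * Real.pi) : ℝ) : ℂ)⁻¹ *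
        ∫ t : ℝ, Complex.exp (-Complex.I * (ξ : ℂ) * (t : ℂ)) * ((W t : ℝ) : ℂ) =
      -Complex.I / (((Real.sqrt (2 * Real.pi) : ℝ) : ℂ) * (ξ : ℂ))

variable {Γ : Type*} [DecidableEq Γ] {q : Γ → ℕ}

/-- The Heisenberg dynamics `τ_t(A) = e^{itH} A e^{-itH}` of a time-independent Hamiltonian, the
solution of `-i (d/dt) τ_t(A) = [H, τ_t(A)]`, `τ_0(A) = A`. -/
def heisenberg {Λ : Finset Γ} (H : Obs q Λ) (t : ℝ) (A : Obs q Λ) : Obs q Λ :=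
  NormedSpace.exp ((Complex.I * (t : ℂ)) • H) * A * NormedSpace.exp (-(Complex.I * (t : ℂ)) • H)

/-- The map `𝓘`: the family `𝓘_s^Λ(B_s^Λ) = ∫ W(t) τ_t^{s,Λ}(B_s^Λ) dt`, where `τ^{s,Λ}` is the
dynamics of `H_s^Λ` with `s` frozen. -/
def spectralMap (W : ℝ → ℝ) (H B : OpFamily q) : OpFamily q := fun Λ s =>
  ∫ t : ℝ, ((W t : ℝ) : ℂ) • heisenberg (H Λ s) t (B Λ s)

/-- The time derivative on `[0, 1]` of a family of operators. -/
def opDeriv (H : OpFamily q) : OpFamily q := fun Λ s =>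
  derivWithin (fun u => H Λ u) (Set.Icc (0 : ℝ) 1) s

/-- The generator `K = 𝓘(dH/ds)` of the spectral flow. -/
def spectralFlowGenerator (W : ℝ → ℝ) (H : OpFamily q) : OpFamily q :=
  spectralMap W H (opDeriv H)

end Flow

end SpinSystem

end

open SpinSystem

/-!
The map `𝓘` preserves locality because the dynamics is quasi-local. Let `Ψ` be an interaction of
`B`, let `X ⊆ Λ`, and let `X_n` be the set of sites of `Λ` within distance `n` of `X`. The time
average of `Ψ(X)` under the full dynamics telescopes into layers (`layer`): the `n`-th layer is the
difference of the time averages under the dynamics of `X_n` and of `X_{n-1}`, an observable on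
`X_n`. The interaction of `𝓘(B)` (`averagedTerms`) assigns the layer to the set `X_n`.

The layers are small by `norm_evolve_sum_sub_le`, which plays the role of the Lieb–Robinson bound
but compares two dynamics directly. Splitting off from each Hamiltonian the terms that commute with
an observable `a`, one sees that the difference of the two evolutions of `a` is controlled by the
differences of the evolutions of the terms touching the support of `a` (`norm_evolve_sub_le`). This
is a linear integral inequality, and a weight of the form `e^{ν dist}` turns it into a bound linear
in `|X|`. With `v` the resulting velocity constant, the `n`-th layer is at most
`|X| ‖Ψ(X)‖ ∫ |W(t)| min(2, e^{v|t| - νn}) dt` (`norm_layer_le`), and the integral decays faster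
than any power of `n` because `W` has all moments. The factor `|X|` is the loss of one power of the
support size in the interaction norm.

Summing the layers, the pair sums of the new interaction decay faster than any power of the distance
(`memBS_averagedTerms`), and every such bound is dominated by a function of the class `𝓢`, namely an
infinite product `∏ₖ (1 + r / aₖ)⁻¹` with `aₖ` growing fast enough (`exists_isFastDecaying_ge`). The
construction does not depend on the power `n`, which gives the case `n = ∞`; the generator of the
spectral flow is the case in which `Ψ` is the time derivative of the interaction of `H`.
-/

namespace SpinSystem

open MeasureTheory

/-! ### Comparison of two Heisenberg dynamics in a C⋆-algebra -/


section CStar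

variable {𝔸 : Type*} [CStarAlgebra 𝔸]

/-- The propagator `e^{ith}`. -/
noncomputable def propagator (h : 𝔸) (t : ℝ) : 𝔸 := NormedSpace.exp ((Complex.I * (t : ℂ)) • h)

/-- The Heisenberg evolution `e^{ith} a e^{-ith}` in a C⋆-algebra. -/
noncomputable def evolve (h : 𝔸) (t : ℝ) (a : 𝔸) : 𝔸 :=
  NormedSpace.exp ((Complex.I * (t : ℂ)) • h) * a * NormedSpace.exp (-(Complex.I * (t : ℂ)) • h)

theorem evolve_eq (h : 𝔸) (t : ℝ) (a : 𝔸) :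
    evolve h t a = propagator h t * a * propagator h (-t) := by
  simp [evolve, propagator]

theorem propagator_neg (h : 𝔸) (t : ℝ) : propagator (-h) t = propagator h (-t) := by
  simp [propagator]

theorem evolve_neg (h : 𝔸) (t : ℝ) (a : 𝔸) : evolve (-h) t a = evolve h (-t) a := by
  simp [evolve_eq, propagator_neg]

theorem propagator_zero (h : 𝔸) : propagator h 0 = 1 := by
  simp [propagator]

theorem propagator_eq_real (h : 𝔸) (t : ℝ) :
    propagator h t = NormedSpace.exp (t • (Complex.I • h)) := by
  rw [propagator, mul_comm, mul_smul, Complex.coe_smul]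

theorem hasDerivAt_propagator (h : 𝔸) (t : ℝ) :
    HasDerivAt (propagator h) (propagator h t * (Complex.I • h)) t := by
  have := hasDerivAt_exp_smul_const (𝕂 := ℝ) (Complex.I • h) t
  simpa only [← propagator_eq_real] using this

theorem hasDerivAt_propagator' (h : 𝔸) (t : ℝ) :
    HasDerivAt (propagator h) ((Complex.I • h) * propagator h t) t := by
  have := hasDerivAt_exp_smul_const' (𝕂 := ℝ) (Complex.I • h) t
  simpa only [← propagator_eq_real] using this

theorem continuous_propagator (h : 𝔸) : Continuous (propagator h) :=
  continuous_iff_continuousAt.2 fun t => (hasDerivAt_propagator h t).continuousAt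

theorem continuous_evolve (h a : 𝔸) : Continuous fun t => evolve h t a := by
  simp only [evolve_eq]
  have := continuous_propagator h
  fun_prop

theorem propagator_mul_neg (h : 𝔸) (t : ℝ) : propagator h t * propagator h (-t) = 1 := by
  rw [← propagator_neg]
  simp only [propagator, smul_neg]
  let +nondep : NormedAlgebra ℚ 𝔸 := .restrictScalars ℚ ℂ 𝔸
  rw [← NormedSpace.exp_add_of_commute (Commute.refl _).neg_right, add_neg_cancel,
    NormedSpace.exp_zero]

theorem propagator_neg_mul (h : 𝔸) (t : ℝ) : propagator h (-t) * propagator h t = 1 := by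
  simpa using propagator_mul_neg h (-t)

theorem propagator_mem_unitary {h : 𝔸} (hh : IsSelfAdjoint h) (t : ℝ) :
    propagator h t ∈ unitary 𝔸 := by
  let +nondep : NormedAlgebra ℚ 𝔸 := .restrictScalars ℚ ℂ 𝔸
  apply NormedSpace.exp_mem_unitary_of_mem_skewAdjoint
  rw [skewAdjoint.mem_iff, star_smul, hh.star_eq]
  simp

theorem star_propagator {h : 𝔸} (hh : IsSelfAdjoint h) (t : ℝ) :
    star (propagator h t) = propagator h (-t) := by
  rw [propagator, NormedSpace.star_exp, star_smul, hh.star_eq, propagator]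
  simp

theorem norm_propagator_mul {h : 𝔸} (hh : IsSelfAdjoint h) (t : ℝ) (a : 𝔸) :
    ‖propagator h t * a‖ = ‖a‖ :=
  CStarRing.norm_coe_unitary_mul ⟨_, propagator_mem_unitary hh t⟩ a

theorem norm_mul_propagator {h : 𝔸} (hh : IsSelfAdjoint h) (t : ℝ) (a : 𝔸) :
    ‖a * propagator h t‖ = ‖a‖ :=
  CStarRing.norm_mul_coe_unitary a ⟨_, propagator_mem_unitary hh t⟩

theorem norm_evolve {h : 𝔸} (hh : IsSelfAdjoint h) (t : ℝ) (a : 𝔸) : ‖evolve h t a‖ = ‖a‖ := by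
  rw [evolve_eq, norm_mul_propagator hh, norm_propagator_mul hh]

theorem isSelfAdjoint_evolve {h a : 𝔸} (hh : IsSelfAdjoint h) (t : ℝ) (ha : IsSelfAdjoint a) :
    IsSelfAdjoint (evolve h t a) := by
  rw [IsSelfAdjoint, evolve_eq, star_mul, star_mul, ha.star_eq, star_propagator hh,
    star_propagator hh, neg_neg, mul_assoc]

theorem evolve_sum {ι : Type*} (s : Finset ι) (h : 𝔸) (t : ℝ) (a : ι → 𝔸) :
    evolve h t (∑ i ∈ s, a i) = ∑ i ∈ s, evolve h t (a i) := by
  simp [evolve, Finset.mul_sum, Finset.sum_mul]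

theorem commute_propagator {a h : 𝔸} (hc : Commute a h) (t : ℝ) : Commute a (propagator h t) := by
  let +nondep : NormedAlgebra ℚ 𝔸 := .restrictScalars ℚ ℂ 𝔸
  exact (hc.smul_right _).exp_right

/-- Let `qᵢ` be a part of `hᵢ` that commutes with `a`. The evolutions of `a` under `h₁` and `h₂`
differ only through the remaining parts `hᵢ - qᵢ`: if `φ'` bounds the difference between the
evolutions of these parts, then `2 ‖a‖ φ` bounds the difference between the evolutions of `a`. -/
theorem norm_evolve_sub_le {h₁ h₂ q₁ q₂ a : 𝔸} (hh₁ : IsSelfAdjoint h₁) (hh₂ : IsSelfAdjoint h₂)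
    (hq₁ : IsSelfAdjoint q₁) (hq₂ : IsSelfAdjoint q₂) (hc₁ : Commute a q₁) (hc₂ : Commute a q₂)
    {φ φ' : ℝ → ℝ} (h0 : 0 ≤ φ 0) (hφ : ∀ s, HasDerivAt φ (φ' s) s)
    (hb : ∀ s, 0 ≤ s → ‖evolve h₁ s (h₁ - q₁) - evolve h₂ s (h₂ - q₂)‖ ≤ φ' s)
    {t : ℝ} (ht : 0 ≤ t) :
    ‖evolve h₁ t a - evolve h₂ t a‖ ≤ 2 * ‖a‖ * φ t := by
  -- As `a` commutes with `qᵢ`, conjugation by `e^{ishᵢ} e^{-isqᵢ}` is the evolution of `a`. So the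
  -- two evolutions differ by the commutator of `a` with `u s * v s`, whose derivative is bounded.
  let u : ℝ → 𝔸 := fun s => propagator q₁ s * propagator h₁ (-s)
  let v : ℝ → 𝔸 := fun s => propagator h₂ s * propagator q₂ (-s)
  have hn : ∀ (h : 𝔸) (s : ℝ), HasDerivAt (fun s => propagator h (-s))
      (-((Complex.I • h) * propagator h (-s))) s := by
    intro h s
    have := (hasDerivAt_propagator' h (-s)).scomp s (hasDerivAt_neg s)
    simpa [Function.comp_def] using this
  have hu : ∀ s, HasDerivAt u (-(u s * (Complex.I • evolve h₁ s (h₁ - q₁)))) s := by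
    intro s
    refine ((hasDerivAt_propagator q₁ s).mul (hn h₁ s)).congr_deriv ?_
    simp only [u, evolve_eq]
    have := propagator_neg_mul h₁ s
    calc _ = -(propagator q₁ s * 1 * (Complex.I • (h₁ - q₁)) * propagator h₁ (-s)) := by
          rw [smul_sub]; noncomm_ring
      _ = _ := by
          rw [← this]; simp only [mul_smul_comm, smul_mul_assoc, mul_assoc]
  have hv : ∀ s, HasDerivAt v ((Complex.I • evolve h₂ s (h₂ - q₂)) * v s) s := by
    intro s
    refine ((hasDerivAt_propagator h₂ s).mul (hn q₂ s)).congr_deriv ?_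
    simp only [v, evolve_eq]
    have := propagator_neg_mul h₂ s
    calc _ = propagator h₂ s * (Complex.I • (h₂ - q₂)) * 1 * propagator q₂ (-s) := by
          rw [smul_sub]; noncomm_ring
      _ = _ := by
          rw [← this]; simp only [mul_smul_comm, smul_mul_assoc, mul_assoc]
  have huv : ∀ s, HasDerivAt (fun s => u s * v s - 1)
      (-(u s * (Complex.I • (evolve h₁ s (h₁ - q₁) - evolve h₂ s (h₂ - q₂))) * v s)) s := by
    intro s
    refine (((hu s).mul (hv s)).sub_const 1).congr_deriv ?_
    rw [smul_sub]; noncomm_ring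
  have hnu : ∀ s b, ‖u s * b‖ = ‖b‖ := fun s b => by
    simp only [u, mul_assoc, norm_propagator_mul hq₁, norm_propagator_mul hh₁]
  have hnv : ∀ s b, ‖b * v s‖ = ‖b‖ := fun s b => by
    simp only [v, ← mul_assoc, norm_mul_propagator hq₂, norm_mul_propagator hh₂]
  have key : ‖u t * v t - 1‖ ≤ φ t := by
    refine image_norm_le_of_norm_deriv_right_le_deriv_boundary (a := 0) (b := t)
      (f := fun s => u s * v s - 1)
      (fun s _ => (huv s).continuousAt.continuousWithinAt) (fun s _ => (huv s).hasDerivWithinAt)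
      ?_ hφ (fun s hs => ?_) ⟨ht, le_rfl⟩
    · simpa [u, v, propagator_zero] using h0
    · rw [norm_neg, hnv, hnu, norm_smul, Complex.norm_I, one_mul]
      exact hb s hs.1
  have e1 : u t * evolve h₁ t a = a * u t := by
    simp only [u, evolve_eq]
    calc _ = propagator q₁ t * (propagator h₁ (-t) * propagator h₁ t) * a * propagator h₁ (-t) := by
          noncomm_ring
      _ = propagator q₁ t * a * propagator h₁ (-t) := by rw [propagator_neg_mul, mul_one]
      _ = _ := by rw [← (commute_propagator hc₁ t).eq, mul_assoc]
  have e2 : evolve h₂ t a * v t = v t * a := by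
    simp only [v, evolve_eq]
    calc _ = propagator h₂ t * a * (propagator h₂ (-t) * propagator h₂ t) * propagator q₂ (-t) := by
          noncomm_ring
      _ = propagator h₂ t * (a * propagator q₂ (-t)) := by
          rw [propagator_neg_mul, mul_one, mul_assoc]
      _ = _ := by rw [(commute_propagator hc₂ (-t)).eq, mul_assoc]
  calc ‖evolve h₁ t a - evolve h₂ t a‖ = ‖u t * (evolve h₁ t a - evolve h₂ t a) * v t‖ := by
        rw [hnv, hnu]
    _ = ‖a * (u t * v t - 1) - (u t * v t - 1) * a‖ := by
        congr 1
        calc _ = (u t * evolve h₁ t a) * v t - u t * (evolve h₂ t a * v t) := by noncomm_ring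
          _ = _ := by rw [e1, e2]; noncomm_ring
    _ ≤ ‖a‖ * ‖u t * v t - 1‖ + ‖u t * v t - 1‖ * ‖a‖ :=
        (norm_sub_le _ _).trans (add_le_add (norm_mul_le _ _) (norm_mul_le _ _))
    _ = 2 * ‖a‖ * ‖u t * v t - 1‖ := by ring
    _ ≤ 2 * ‖a‖ * φ t := by gcongr

variable {Γ : Type*} [DecidableEq Γ]

theorem sum_filter_not_disjoint_le {S : Finset (Finset Γ)} (X : Finset Γ) {f : Finset Γ → ℝ}
    (hf : ∀ Z ∈ S, 0 ≤ f Z) :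
    ∑ Z ∈ S with ¬ Disjoint Z X, f Z ≤ ∑ x ∈ X, ∑ Z ∈ S with x ∈ Z, f Z := by
  simp only [Finset.sum_filter]
  rw [Finset.sum_comm]
  refine Finset.sum_le_sum fun Z hZ => ?_
  have h0 : ∀ x ∈ X, 0 ≤ if x ∈ Z then f Z else 0 := fun x _ => by
    split_ifs <;> simp [hf Z hZ]
  split_ifs with h
  · exact Finset.sum_nonneg h0
  · obtain ⟨x, hxZ, hxX⟩ := Finset.not_disjoint_iff.1 h
    calc f Z = if x ∈ Z then f Z else 0 := by simp [hxZ]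
      _ ≤ _ := Finset.single_le_sum h0 hxX

/-- Quasi-locality of the Heisenberg dynamics, in a form that needs no Lieb–Robinson commutator
bound. Let `h Z` be local terms, so that terms with disjoint supports commute, and let `w` be a
weight that is reproduced by the terms up to the factor `M`. If the terms in `S₂ \ S₁` have weight
at least one, then the dynamics generated by `S₁` and `S₂` differ on an observable supported in `X`
by at most `e^{4M|t|}` times the weight of `X`. -/
theorem norm_evolve_sum_sub_le {S₁ S₂ : Finset (Finset Γ)} (hS : S₁ ⊆ S₂) {h : Finset Γ → 𝔸}
    (hsa : ∀ Z ∈ S₂, IsSelfAdjoint (h Z))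
    (hcomm : ∀ Z ∈ S₂, ∀ Z' ∈ S₂, Disjoint Z Z' → Commute (h Z') (h Z))
    {w : Γ → ℝ} {c : ℝ} (hc : 0 < c) (hcw : ∀ x, c ≤ w x)
    (hw : ∀ Z ∈ S₂, Z ∉ S₁ → 1 ≤ ∑ z ∈ Z, w z) {M : ℝ} (hM0 : 0 < M)
    (hM : ∀ x, ∑ Z ∈ S₂ with x ∈ Z, ‖h Z‖ * ∑ z ∈ Z, w z ≤ M * w x)
    {X : Finset Γ} (hX : X.Nonempty) {a : 𝔸} (ha : ∀ Z ∈ S₂, Disjoint Z X → Commute a (h Z))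
    (t : ℝ) :
    ‖evolve (∑ Z ∈ S₁, h Z) t a - evolve (∑ Z ∈ S₂, h Z) t a‖ ≤
      ‖a‖ * (∑ x ∈ X, w x) * Real.exp (4 * M * |t|) := by
  wlog ht : 0 ≤ t generalizing t h
  · have := this (h := fun Z => - h Z) (fun Z hZ => (hsa Z hZ).neg)
      (fun Z hZ Z' hZ' hd => ((hcomm Z hZ Z' hZ' hd).neg_left).neg_right)
      (by simpa using hM) (fun Z hZ hd => (ha Z hZ hd).neg_right) (-t) (by linarith)
    simpa [evolve_neg] using this
  rw [abs_of_nonneg ht]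
  have hw0 : ∀ x, 0 < w x := fun x => hc.trans_le (hcw x)
  have hW0 : ∀ Y : Finset Γ, 0 ≤ ∑ y ∈ Y, w y := fun Y => Finset.sum_nonneg fun y _ => (hw0 y).le
  set h₁ := ∑ Z ∈ S₁, h Z with hh₁
  set h₂ := ∑ Z ∈ S₂, h Z with hh₂
  have sa₁ : IsSelfAdjoint h₁ := isSelfAdjoint_sum _ fun Z hZ => hsa Z (hS hZ)
  have sa₂ : IsSelfAdjoint h₂ := isSelfAdjoint_sum _ fun Z hZ => hsa Z hZ
  let P : ℝ → Prop := fun K => ∀ (X : Finset Γ), X.Nonempty → ∀ a : 𝔸,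
    (∀ Z ∈ S₂, Disjoint Z X → Commute a (h Z)) → ∀ t, 0 ≤ t →
      ‖evolve h₁ t a - evolve h₂ t a‖ ≤ ‖a‖ * (∑ x ∈ X, w x) * (K * Real.exp (4 * M * t))
  have base : P (2 / c) := by
    intro X hX a _ t ht
    obtain ⟨x, hx⟩ := hX
    have h1 : c ≤ ∑ x ∈ X, w x :=
      (hcw x).trans (Finset.single_le_sum (fun y _ => (hw0 y).le) hx)
    have h2 : 1 ≤ Real.exp (4 * M * t) := Real.one_le_exp (by positivity)
    calc ‖evolve h₁ t a - evolve h₂ t a‖ ≤ ‖evolve h₁ t a‖ + ‖evolve h₂ t a‖ := norm_sub_le _ _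
      _ = ‖a‖ * c * (2 / c * 1) := by
          rw [norm_evolve sa₁, norm_evolve sa₂]; field_simp; ring
      _ ≤ _ := by gcongr; exact mul_nonneg (norm_nonneg _) (hW0 X)
  -- one application of the integral inequality halves the excess of the constant over `1`
  have step : ∀ K, 0 ≤ K → P K → P (K / 2 + 1 / 2) := by
    intro K hK hP X hX a ha t ht
    set wX := ∑ x ∈ X, w x with hwX
    have key := norm_evolve_sub_le (a := a) sa₁ sa₂ (q₁ := ∑ Z ∈ S₁ with Disjoint Z X, h Z)
      (q₂ := ∑ Z ∈ S₂ with Disjoint Z X, h Z)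
      (isSelfAdjoint_sum _ fun Z hZ => hsa Z (hS (Finset.mem_filter.1 hZ).1))
      (isSelfAdjoint_sum _ fun Z hZ => hsa Z (Finset.mem_filter.1 hZ).1)
      (Commute.sum_right _ _ _ fun Z hZ =>
        ha Z (hS (Finset.mem_filter.1 hZ).1) (Finset.mem_filter.1 hZ).2)
      (Commute.sum_right _ _ _ fun Z hZ =>
        ha Z (Finset.mem_filter.1 hZ).1 (Finset.mem_filter.1 hZ).2)
      (φ := fun s => M * wX * (K * (Real.exp (4 * M * s) / (4 * M)) + s))
      (φ' := fun s => M * wX * (K * Real.exp (4 * M * s) + 1)) ?_ ?_ ?_ ht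
    · refine key.trans ?_
      have h1 : 4 * M * t ≤ Real.exp (4 * M * t) := by
        linarith [Real.add_one_le_exp (4 * M * t)]
      calc 2 * ‖a‖ * (M * wX * (K * (Real.exp (4 * M * t) / (4 * M)) + t))
          = ‖a‖ * wX * (K / 2 * Real.exp (4 * M * t) + 1 / 2 * (4 * M * t)) := by
            field_simp; ring
        _ ≤ ‖a‖ * wX * (K / 2 * Real.exp (4 * M * t) + 1 / 2 * Real.exp (4 * M * t)) := by
            have := hW0 X
            gcongr
        _ = _ := by ring
    · have := hW0 X
      positivity
    · intro s
      have h1 : HasDerivAt (fun s => Real.exp (4 * M * s)) (Real.exp (4 * M * s) * (4 * M)) s := by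
        simpa using ((hasDerivAt_id s).const_mul (4 * M)).exp
      refine ((((h1.div_const (4 * M)).const_mul K).add (hasDerivAt_id s)).const_mul
        (M * wX)).congr_deriv ?_
      field_simp
    · intro s hs
      have e : ∀ S : Finset (Finset Γ), ∑ Z ∈ S, h Z - ∑ Z ∈ S with Disjoint Z X, h Z =
          ∑ Z ∈ S with ¬ Disjoint Z X, h Z := fun S => by
        rw [← Finset.sum_filter_add_sum_filter_not S (fun Z => Disjoint Z X), add_sub_cancel_left]
      have e₁ : S₁.filter (fun Z => ¬ Disjoint Z X) =
          (S₂.filter (fun Z => ¬ Disjoint Z X)).filter (· ∈ S₁) := by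
        ext Z
        simp only [Finset.mem_filter]
        exact ⟨fun H => ⟨⟨hS H.1, H.2⟩, H.1⟩, fun H => ⟨H.2, H.1.2⟩⟩
      rw [hh₁, hh₂, e, e, evolve_sum, evolve_sum, ← hh₁, ← hh₂, e₁, Finset.sum_filter (· ∈ S₁),
        ← Finset.sum_sub_distrib]
      have hwX' : ∑ Z ∈ S₂ with ¬ Disjoint Z X, ‖h Z‖ * ∑ z ∈ Z, w z ≤ M * wX := by
        refine (sum_filter_not_disjoint_le X fun Z _ =>
          mul_nonneg (norm_nonneg _) (hW0 Z)).trans ?_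
        rw [hwX, Finset.mul_sum]
        exact Finset.sum_le_sum fun x _ => hM x
      calc _ ≤ ∑ Z ∈ S₂ with ¬ Disjoint Z X,
            (‖h Z‖ * ∑ z ∈ Z, w z) * (K * Real.exp (4 * M * s) + 1) := by
            refine norm_sum_le_of_le _ fun Z hZ => ?_
            obtain ⟨hZ, hd⟩ := Finset.mem_filter.1 hZ
            have hn := mul_nonneg (norm_nonneg (h Z)) (hW0 Z)
            have hKe : 0 ≤ K * Real.exp (4 * M * s) := by positivity
            split_ifs with h1
            · refine (hP Z ?_ (h Z) (fun Z' hZ' hd' => hcomm Z' hZ' Z hZ hd') s hs).trans ?_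
              · obtain ⟨z, hz, -⟩ := Finset.not_disjoint_iff.1 hd
                exact ⟨z, hz⟩
              · gcongr; linarith
            · rw [zero_sub, norm_neg, norm_evolve sa₂]
              calc ‖h Z‖ = ‖h Z‖ * 1 * 1 := by ring
                _ ≤ _ := mul_le_mul (mul_le_mul_of_nonneg_left (hw Z hZ h1) (norm_nonneg _))
                    (by linarith) zero_le_one hn
        _ = (∑ Z ∈ S₂ with ¬ Disjoint Z X, ‖h Z‖ * ∑ z ∈ Z, w z) *
            (K * Real.exp (4 * M * s) + 1) := by rw [Finset.sum_mul]
        _ ≤ _ := by gcongr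
  have iter : ∀ n : ℕ, P (1 + (2 / c) * (1 / 2) ^ n) := by
    intro n
    induction n with
    | zero =>
      intro X hX a ha t ht
      refine (base X hX a ha t ht).trans ?_
      have := hW0 X
      gcongr
      simp
    | succ n ih =>
      have := step _ (by positivity) ih
      convert this using 1
      ring
  have lim : Filter.Tendsto (fun n : ℕ => ‖a‖ * (∑ x ∈ X, w x) *
      ((1 + (2 / c) * (1 / 2) ^ n) * Real.exp (4 * M * t))) Filter.atTop
      (nhds (‖a‖ * (∑ x ∈ X, w x) * ((1 + (2 / c) * 0) * Real.exp (4 * M * t)))) := by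
    refine Filter.Tendsto.const_mul _ (Filter.Tendsto.mul_const _
      (Filter.Tendsto.const_add _ (Filter.Tendsto.const_mul _ ?_)))
    exact tendsto_pow_atTop_nhds_zero_of_lt_one (by norm_num) (by norm_num)
  have := ge_of_tendsto' lim fun n => iter n X hX a ha t ht
  simpa using this

end CStar

/-! ### The embeddings of local algebras -/


section Embed

variable {Γ : Type*} [DecidableEq Γ] {q : Γ → ℕ} {X Y Z : Finset Γ}

/-- The configuration on `Y` that agrees with `k` on `X` and with `i` elsewhere. -/
def glue (k : Config q X) (i : Config q Y) : Config q Y :=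
  fun y => if h : y.1 ∈ X then k ⟨y.1, h⟩ else i y

theorem embed_self (A : Obs q X) (h : X ⊆ X) : embed h A = A := by
  ext i j
  simp [embed]

theorem embed_embed (h : X ⊆ Y) (h' : Y ⊆ Z) (A : Obs q X) :
    embed h' (embed h A) = embed (h.trans h') A := by
  ext i j
  simp only [embed, mul_assoc]
  congr 1
  rw [ite_zero_mul_ite_zero, mul_one]
  congr 1
  rw [eq_iff_iff]
  constructor
  · rintro ⟨h1, h2⟩ z hz
    by_cases hzY : z.1 ∈ Y
    · exact h1 ⟨z.1, hzY⟩ hz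
    · exact h2 z hzY
  · intro H
    exact ⟨fun y hy => H ⟨y.1, h' y.2⟩ hy, fun z hz => H z fun hzX => hz (h hzX)⟩

theorem embed_one (h : X ⊆ Y) : embed h (1 : Obs q X) = 1 := by
  ext i j
  simp only [embed, Matrix.one_apply]
  rw [ite_zero_mul_ite_zero, mul_one]
  congr 1
  rw [eq_iff_iff]
  constructor
  · rintro ⟨h1, h2⟩
    funext y
    by_cases hy : y.1 ∈ X
    · exact congrFun h1 ⟨y.1, hy⟩
    · exact h2 y hy
  · rintro rfl
    exact ⟨rfl, fun _ _ => rfl⟩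

theorem embed_mul (h : X ⊆ Y) (A B : Obs q X) : embed h (A * B) = embed h A * embed h B := by
  ext i j
  simp only [embed, Matrix.mul_apply, Finset.sum_mul]
  refine Finset.sum_of_injOn (fun k => glue k i) ?_ (by simp) ?_ ?_
  · intro k _ l _ hkl
    funext x
    have := congrFun hkl ⟨x.1, h x.2⟩
    simpa [glue] using this
  · intro k _ hk
    by_cases h1 : ∀ y : Y, y.1 ∉ X → i y = k y
    · refine absurd ⟨fun x => k ⟨x.1, h x.2⟩, by simp, ?_⟩ hk
      funext y
      by_cases hy : y.1 ∈ X <;> simp [glue, hy, h1 y]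
    · simp only [if_neg h1, mul_zero, zero_mul]
  · intro k _
    have h1 : (fun x : X => glue k i ⟨x.1, h x.2⟩) = k := by
      funext x
      simp [glue]
    have h2 : ∀ y : Y, y.1 ∉ X → i y = glue k i y := fun y hy => by simp [glue, hy]
    have h3 : (∀ y : Y, y.1 ∉ X → glue k i y = j y) ↔ ∀ y : Y, y.1 ∉ X → i y = j y :=
      forall₂_congr fun y hy => by rw [h2 y hy]
    rw [h1, if_pos h2]
    simp only [h3]
    ring

theorem embed_add (h : X ⊆ Y) (A B : Obs q X) : embed h (A + B) = embed h A + embed h B := by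
  ext i j
  simp only [embed, Matrix.add_apply, add_mul]

theorem embed_smul (h : X ⊆ Y) (c : ℂ) (A : Obs q X) : embed h (c • A) = c • embed h A := by
  ext i j
  simp [embed]

theorem embed_star (h : X ⊆ Y) (A : Obs q X) : embed h (star A) = star (embed h A) := by
  ext i j
  simp only [embed, Matrix.star_apply, star_mul', apply_ite star, star_one, star_zero]
  simp only [eq_comm]

/-- The embedding of local algebras as a homomorphism of ⋆-algebras. -/
def embedHom (h : X ⊆ Y) : Obs q X →⋆ₐ[ℂ] Obs q Y where
  toFun := embed h
  map_one' := embed_one h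
  map_mul' := embed_mul h
  map_zero' := by ext; simp [embed]
  map_add' := embed_add h
  commutes' c := by rw [Algebra.algebraMap_eq_smul_one, embed_smul, embed_one,
    Algebra.algebraMap_eq_smul_one]
  map_star' := embed_star h

theorem embed_zero (h : X ⊆ Y) : embed h (0 : Obs q X) = 0 := map_zero (embedHom h)

theorem embed_sub (h : X ⊆ Y) (A B : Obs q X) : embed h (A - B) = embed h A - embed h B :=
  map_sub (embedHom h) A B

theorem embed_sum {ι : Type*} (s : Finset ι) (h : X ⊆ Y) (A : ι → Obs q X) :
    embed h (∑ i ∈ s, A i) = ∑ i ∈ s, embed h (A i) :=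
  map_sum (embedHom h) A s

theorem norm_embed_le (h : X ⊆ Y) (A : Obs q X) : ‖embed h A‖ ≤ ‖A‖ :=
  NonUnitalStarAlgHom.norm_apply_le (embedHom h) A

theorem isSelfAdjoint_embed (h : X ⊆ Y) {A : Obs q X} (hA : IsSelfAdjoint A) :
    IsSelfAdjoint (embed h A) := by
  rw [IsSelfAdjoint, ← embed_star, hA.star_eq]

/-- The embedding of local algebras as a continuous linear map. -/
noncomputable def embedCLM (h : X ⊆ Y) : Obs q X →L[ℂ] Obs q Y :=
  LinearMap.mkContinuous (embedHom h).toAlgHom.toLinearMap 1 fun A => by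
    rw [one_mul]; exact norm_embed_le h A

theorem embedCLM_apply (h : X ⊆ Y) (A : Obs q X) : embedCLM h A = embed h A := rfl

theorem embed_mul_embed_apply (hX : X ⊆ Y) (hZ : Z ⊆ Y) (hd : Disjoint X Z) (A : Obs q X)
    (B : Obs q Z) (i j : Config q Y) :
    (embed hX A * embed hZ B) i j =
      A (fun x => i ⟨x.1, hX x.2⟩) (fun x => j ⟨x.1, hX x.2⟩) *
        B (fun x => i ⟨x.1, hZ x.2⟩) (fun x => j ⟨x.1, hZ x.2⟩) *
        if ∀ y : Y, y.1 ∉ X → y.1 ∉ Z → i y = j y then 1 else 0 := by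
  rw [Matrix.mul_apply, Finset.sum_eq_single (fun y => if y.1 ∈ X then j y else i y)]
  · have hZX : ∀ x : Z, x.1 ∉ X := fun x hx => Finset.disjoint_left.1 hd hx x.2
    have h1 : ∀ y : Y, y.1 ∉ X → i y = if y.1 ∈ X then j y else i y := fun y hy => by simp [hy]
    have h2 : (∀ y : Y, y.1 ∉ Z → (if y.1 ∈ X then j y else i y) = j y) ↔
        ∀ y : Y, y.1 ∉ X → y.1 ∉ Z → i y = j y := by
      refine forall_congr' fun y => ?_
      by_cases hy : y.1 ∈ X <;> simp [hy]
    simp only [embed]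
    rw [if_pos h1]
    simp only [h2]
    simp [hZX]
  · intro k _ hk
    by_cases h1 : ∀ y : Y, y.1 ∉ X → i y = k y
    · by_cases h2 : ∀ y : Y, y.1 ∉ Z → k y = j y
      · refine absurd (funext fun y => ?_) hk
        by_cases hy : y.1 ∈ X
        · simp [hy, h2 y (Finset.disjoint_left.1 hd hy)]
        · simp [hy, h1 y hy]
      · simp only [embed, if_neg h2, mul_zero]
    · simp only [embed, if_neg h1, mul_zero, zero_mul]
  · simp

theorem commute_embed (hX : X ⊆ Y) (hZ : Z ⊆ Y) (hd : Disjoint X Z) (A : Obs q X) (B : Obs q Z) :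
    Commute (embed hX A) (embed hZ B) := by
  ext i j
  rw [embed_mul_embed_apply hX hZ hd, embed_mul_embed_apply hZ hX hd.symm, mul_comm (B _ _)]
  congr 3
  rw [eq_iff_iff]
  exact forall_congr' fun y => imp.swap

theorem embed_evolve (h : X ⊆ Y) (H : Obs q X) (t : ℝ) (A : Obs q X) :
    embed h (evolve H t A) = evolve (embed h H) t (embed h A) := by
  have he : ∀ B : Obs q X, embed h (NormedSpace.exp B) = NormedSpace.exp (embed h B) := by
    intro B
    let +nondep : NormedAlgebra ℚ (Obs q X) := .restrictScalars ℚ ℂ (Obs q X)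
    let +nondep : Algebra ℚ (Obs q Y) := (NormedAlgebra.restrictScalars ℚ ℂ (Obs q Y)).toAlgebra
    exact NormedSpace.map_exp (embedHom h) (embedCLM h).continuous B
  rw [evolve, embed_mul, embed_mul, he, he, embed_smul, embed_smul, evolve]

end Embed

section LocalHamiltonian

variable {Γ : Type*} [DecidableEq Γ] {q : Γ → ℕ} {X Y Z : Finset Γ}

/-- The observable `A` on `X` as an observable on `Y`; zero unless `X ⊆ Y`. Having this for
arbitrary `X` and `Y` avoids carrying proofs of inclusions through sums. -/
def extend (Y : Finset Γ) (A : Obs q X) : Obs q Y :=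
  if h : X ⊆ Y then embed h A else 0

theorem extend_of_subset (h : X ⊆ Y) (A : Obs q X) : extend Y A = embed h A := dif_pos h

theorem extend_zero : extend Y (0 : Obs q X) = 0 := by
  rw [extend]
  split_ifs with h
  · exact embed_zero h
  · rfl

theorem extend_sum {ι : Type*} (s : Finset ι) (A : ι → Obs q X) :
    extend Y (∑ i ∈ s, A i) = ∑ i ∈ s, extend Y (A i) := by
  by_cases h : X ⊆ Y
  · simp only [extend_of_subset h, embed_sum]
  · simp [extend, h]

theorem extend_extend (h : X ⊆ Y) (h' : Y ⊆ Z) (A : Obs q X) :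
    extend Z (extend Y A) = extend Z A := by
  rw [extend_of_subset h, extend_of_subset h', extend_of_subset (h.trans h'), embed_embed]

theorem isSelfAdjoint_extend (Y : Finset Γ) {A : Obs q X} (hA : IsSelfAdjoint A) :
    IsSelfAdjoint (extend Y A) := by
  rw [extend]
  split_ifs with h
  · exact isSelfAdjoint_embed h hA
  · exact .zero _

theorem norm_extend_le (Y : Finset Γ) (A : Obs q X) : ‖extend Y A‖ ≤ ‖A‖ := by
  rw [extend]
  split_ifs with h
  · exact norm_embed_le h _
  · simp

theorem commute_extend (Y : Finset Γ) (hd : Disjoint Z X) (A : Obs q X) (B : Obs q Z) :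
    Commute (extend Y A) (extend Y B) := by
  rw [extend, extend]
  split_ifs with h h'
  · exact commute_embed h h' hd.symm _ _
  all_goals simp

/-- The Hamiltonian `∑_{Z ⊆ Y} φ Z` of the finite volume `Y`. -/
def localHam (φ : (Z : Finset Γ) → Obs q Z) (Y : Finset Γ) : Obs q Y :=
  ∑ Z ∈ Y.powerset, extend Y (φ Z)

theorem hamiltonian_eq_localHam (Φ : Terms q) (Λ : Finset Γ) (s : ℝ) :
    hamiltonian Φ Λ s = localHam (Φ Λ s) Λ := by
  rw [hamiltonian, localHam, ← Finset.sum_attach Λ.powerset]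
  exact Finset.sum_congr rfl fun X _ => (extend_of_subset _ _).symm

theorem extend_localHam (φ : (Z : Finset Γ) → Obs q Z) (h : X ⊆ Y) :
    extend Y (localHam φ X) = ∑ Z ∈ X.powerset, extend Y (φ Z) := by
  rw [localHam, extend_sum]
  exact Finset.sum_congr rfl fun Z hZ => extend_extend (Finset.mem_powerset.1 hZ) h _

theorem isSelfAdjoint_localHam {φ : (Z : Finset Γ) → Obs q Z} (hφ : ∀ Z, IsSelfAdjoint (φ Z))
    (Y : Finset Γ) : IsSelfAdjoint (localHam φ Y) :=
  isSelfAdjoint_sum _ fun Z _ => isSelfAdjoint_extend Y (hφ Z)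

theorem extend_evolve (h : X ⊆ Y) (H : Obs q X) (t : ℝ) (A : Obs q X) :
    extend Y (evolve H t A) = evolve (extend Y H) t (extend Y A) := by
  simp only [extend_of_subset h, embed_evolve]

end LocalHamiltonian

/-! ### Weighted time averages -/

section TimeAverage

theorem IsWeight.integrable_moment {γ : ℝ} {W : ℝ → ℝ} (hW : IsWeight γ W) (p : ℕ) :
    Integrable fun t => |W t| * (1 + |t|) ^ p := by
  obtain ⟨K, hK⟩ := hW.fast (p + 2)
  have hK' : ∀ t : ℝ, 1 < |t| → |t| ^ (p + 2) * |W t| ≤ K := fun t ht => hK ⟨t, ht, rfl⟩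
  have hK0 : 0 ≤ K := le_trans (by positivity) (hK' 2 (by norm_num))
  have hint : Integrable fun t => 2 ^ p * |W t| + 2 ^ p * K * 2 * (1 + t ^ 2)⁻¹ :=
    (hW.integrable.abs.const_mul _).add (integrable_inv_one_add_sq.const_mul _)
  refine hint.mono' ?_ (Filter.Eventually.of_forall fun t => ?_)
  · exact hW.integrable.abs.aestronglyMeasurable.mul (by fun_prop)
  · rw [Real.norm_of_nonneg (by positivity)]
    rcases le_or_gt |t| 1 with ht | ht
    · have h1 : (1 + |t|) ^ p ≤ 2 ^ p := by gcongr; linarith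
      have h2 : 0 ≤ 2 ^ p * K * 2 * (1 + t ^ 2)⁻¹ := by positivity
      nlinarith [abs_nonneg (W t)]
    · have h1 : (1 + |t|) ^ p ≤ 2 ^ p * |t| ^ p := by
        rw [← mul_pow]; gcongr; linarith
      have ht2 : 1 < |t| ^ 2 := by nlinarith
      have h2 : |W t| * |t| ^ p ≤ K * 2 * (1 + t ^ 2)⁻¹ := by
        rw [← div_eq_mul_inv, le_div_iff₀ (by positivity)]
        calc |W t| * |t| ^ p * (1 + t ^ 2) ≤ |W t| * |t| ^ p * (2 * |t| ^ 2) := by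
              gcongr; rw [← sq_abs]; linarith
          _ = (|t| ^ (p + 2) * |W t|) * 2 := by ring
          _ ≤ K * 2 := by gcongr; exact hK' t ht
      calc |W t| * (1 + |t|) ^ p ≤ |W t| * (2 ^ p * |t| ^ p) := by gcongr
        _ = 2 ^ p * (|W t| * |t| ^ p) := by ring
        _ ≤ 2 ^ p * (K * 2 * (1 + t ^ 2)⁻¹) := by gcongr
        _ ≤ _ := by
          have : 0 ≤ 2 ^ p * |W t| := by positivity
          linarith

/-- The weight of the times at which a signal of speed `v / ν`, with exponential tails of rate
`ν`, has covered the distance `n`. -/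
noncomputable def tailWeight (W : ℝ → ℝ) (v ν : ℝ) (n : ℕ) : ℝ :=
  ∫ t, |W t| * min 2 (Real.exp (v * |t| - ν * n))

theorem integrable_tailWeight {W : ℝ → ℝ} (hW : Integrable W) (v ν : ℝ) (n : ℕ) :
    Integrable fun t => |W t| * min 2 (Real.exp (v * |t| - ν * n)) := by
  refine (hW.abs.mul_const 2).mono' (hW.abs.aestronglyMeasurable.mul
    (by fun_prop)) (Filter.Eventually.of_forall fun t => ?_)
  rw [Real.norm_of_nonneg (by positivity)]
  gcongr
  exact min_le_left _ _

theorem tailWeight_nonneg (W : ℝ → ℝ) (v ν : ℝ) (n : ℕ) : 0 ≤ tailWeight W v ν n :=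
  integral_nonneg fun t => by positivity

theorem min_exp_mul_pow_le {v ν : ℝ} (hv : 0 ≤ v) (hν : 0 < ν) (p n : ℕ) {t : ℝ} (ht : 0 ≤ t) :
    min 2 (Real.exp (v * t - ν * n)) * (1 + n) ^ p ≤
      (2 * (1 + 2 * v / ν) ^ p + p.factorial * (2 / ν) ^ p * Real.exp (ν / 2)) * (1 + t) ^ p := by
  have hp : 1 ≤ (1 + t) ^ p := one_le_pow₀ (by linarith)
  rcases le_or_gt (ν * n) (2 * v * t) with h | h
  · have h1 : (n : ℝ) ≤ 2 * v / ν * t := by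
      rw [div_mul_eq_mul_div, le_div_iff₀ hν]; linarith
    have h2 : (1 + n : ℝ) ≤ (1 + 2 * v / ν) * (1 + t) := by
      have : 0 ≤ 2 * v / ν := by positivity
      nlinarith
    calc min 2 (Real.exp (v * t - ν * n)) * (1 + n) ^ p ≤ 2 * ((1 + 2 * v / ν) * (1 + t)) ^ p := by
          gcongr; exact min_le_left _ _
      _ = (2 * (1 + 2 * v / ν) ^ p + 0) * (1 + t) ^ p := by rw [mul_pow]; ring
      _ ≤ _ := by gcongr; positivity
  · have h1 := Real.pow_div_factorial_le_exp (x := ν / 2 * (1 + n)) (by positivity) p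
    have h2 : (1 + n : ℝ) ^ p = (2 / ν) ^ p * (ν / 2 * (1 + n)) ^ p := by
      rw [← mul_pow]; congr 1; field_simp
    rw [div_le_iff₀ (by positivity)] at h1
    calc min 2 (Real.exp (v * t - ν * n)) * (1 + n) ^ p
        ≤ Real.exp (-(ν / 2 * n)) * ((2 / ν) ^ p *
            (Real.exp (ν / 2 * (1 + n)) * p.factorial)) := by
          rw [h2]
          gcongr
          exact (min_le_right _ _).trans (Real.exp_le_exp.2 (by linarith))
      _ = (Real.exp (-(ν / 2 * n)) * Real.exp (ν / 2 * (1 + n))) * (p.factorial * (2 / ν) ^ p) := by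
          ring
      _ = (0 + p.factorial * (2 / ν) ^ p * Real.exp (ν / 2)) * 1 := by
          rw [← Real.exp_add]
          ring_nf
      _ ≤ _ := by gcongr; positivity

theorem IsWeight.exists_tailWeight_le {γ : ℝ} {W : ℝ → ℝ} (hW : IsWeight γ W) {v ν : ℝ}
    (hv : 0 ≤ v) (hν : 0 < ν) (p : ℕ) :
    ∃ C, 0 ≤ C ∧ ∀ n : ℕ, tailWeight W v ν n * (1 + n) ^ p ≤ C := by
  set c := 2 * (1 + 2 * v / ν) ^ p + p.factorial * (2 / ν) ^ p * Real.exp (ν / 2)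
  have hc : 0 ≤ c := by positivity
  refine ⟨c * ∫ t, |W t| * (1 + |t|) ^ p,
    mul_nonneg hc (integral_nonneg fun t => by positivity), fun n => ?_⟩
  rw [tailWeight, ← integral_mul_const, ← integral_const_mul]
  refine integral_mono ((integrable_tailWeight hW.integrable v ν n).mul_const _)
    ((hW.integrable_moment p).const_mul _) fun t => ?_
  have := min_exp_mul_pow_le hv hν p n (abs_nonneg t)
  calc |W t| * min 2 (Real.exp (v * |t| - ν * n)) * (1 + n) ^ p
      = |W t| * (min 2 (Real.exp (v * |t| - ν * n)) * (1 + n) ^ p) := by ring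
    _ ≤ |W t| * (c * (1 + |t|) ^ p) := by gcongr
    _ = _ := by ring

variable {𝔸 : Type*} [CStarAlgebra 𝔸]

/-- The weighted time average `∫ W(t) e^{ith} a e^{-ith} dt`. -/
noncomputable def timeAverage (W : ℝ → ℝ) (h a : 𝔸) : 𝔸 := ∫ t : ℝ, ((W t : ℝ) : ℂ) • evolve h t a

theorem integrable_smul_evolve {W : ℝ → ℝ} (hW : Integrable W) {h : 𝔸} (hh : IsSelfAdjoint h)
    (a : 𝔸) : Integrable fun t => ((W t : ℝ) : ℂ) • evolve h t a := by
  refine (hW.abs.mul_const ‖a‖).mono' ?_ (Filter.Eventually.of_forall fun t => ?_)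
  · exact hW.ofReal.aestronglyMeasurable.smul (continuous_evolve h a).aestronglyMeasurable
  · rw [norm_smul, norm_evolve hh, Complex.norm_real, Real.norm_eq_abs]

theorem timeAverage_sum {ι : Type*} (s : Finset ι) {W : ℝ → ℝ} (hW : Integrable W) {h : 𝔸}
    (hh : IsSelfAdjoint h) (a : ι → 𝔸) :
    timeAverage W h (∑ i ∈ s, a i) = ∑ i ∈ s, timeAverage W h (a i) := by
  simp only [timeAverage]
  rw [← integral_finsetSum s fun i _ => integrable_smul_evolve hW hh (a i)]
  simp only [evolve_sum, Finset.smul_sum]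

theorem isSelfAdjoint_timeAverage (W : ℝ → ℝ) {h a : 𝔸} (hh : IsSelfAdjoint h)
    (ha : IsSelfAdjoint a) : IsSelfAdjoint (timeAverage W h a) := by
  have := ((starL' ℝ : 𝔸 ≃L[ℝ] 𝔸).integral_comp_comm
    (fun t : ℝ => ((W t : ℝ) : ℂ) • evolve h t a) (μ := volume))
  rw [IsSelfAdjoint, timeAverage]
  refine this.symm.trans (integral_congr_ae (Filter.Eventually.of_forall fun t => ?_))
  simp [(isSelfAdjoint_evolve hh t ha).star_eq]

theorem evolve_of_commute {a h : 𝔸} (hc : Commute a h) (t : ℝ) : evolve h t a = a := by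
  rw [evolve_eq, ← (commute_propagator hc t).eq, mul_assoc, propagator_mul_neg, mul_one]

end TimeAverage

/-! ### Neighbourhoods in a finite volume -/

section Neighbourhood

variable {Γ : Type*} (G : SimpleGraph Γ)

/-- The sites of the volume `Λ` at distance at most `n` from `X`. -/
noncomputable def nbhd (Λ X : Finset Γ) (n : ℕ) : Finset Γ := {z ∈ Λ | ∃ x ∈ X, G.dist x z ≤ n}

/-- The diameter of a finite volume. -/
noncomputable def volumeDiam (Λ : Finset Γ) : ℕ := Λ.sup fun x => Λ.sup fun y => G.dist x y

variable {G}

theorem mem_nbhd {Λ X : Finset Γ} {n : ℕ} {z : Γ} :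
    z ∈ nbhd G Λ X n ↔ z ∈ Λ ∧ ∃ x ∈ X, G.dist x z ≤ n := Finset.mem_filter

theorem nbhd_subset (Λ X : Finset Γ) (n : ℕ) : nbhd G Λ X n ⊆ Λ := Finset.filter_subset _ _

theorem subset_nbhd {Λ X : Finset Γ} (h : X ⊆ Λ) (n : ℕ) : X ⊆ nbhd G Λ X n :=
  fun x hx => mem_nbhd.2 ⟨h hx, x, hx, by simp⟩

theorem nbhd_mono (Λ X : Finset Γ) (n : ℕ) : nbhd G Λ X n ⊆ nbhd G Λ X (n + 1) := fun z hz => by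
  obtain ⟨hz, x, hx, hd⟩ := mem_nbhd.1 hz
  exact mem_nbhd.2 ⟨hz, x, hx, by omega⟩

theorem nbhd_empty (Λ : Finset Γ) (n : ℕ) : nbhd G Λ ∅ n = ∅ := by
  ext z
  simp [mem_nbhd]

theorem nbhd_volumeDiam {Λ X : Finset Γ} (h : X ⊆ Λ) (hX : X.Nonempty) :
    nbhd G Λ X (volumeDiam G Λ) = Λ := by
  refine (nbhd_subset _ _ _).antisymm fun z hz => ?_
  obtain ⟨x, hx⟩ := hX
  refine mem_nbhd.2 ⟨hz, x, hx, ?_⟩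
  exact (Finset.le_sup (f := fun y => G.dist x y) hz).trans
    (Finset.le_sup (f := fun x => Λ.sup fun y => G.dist x y) (h hx))

theorem exists_ball_le {d : ℕ} (hd : IsDimensional G d) :
    ∃ κ : ℝ, 1 ≤ κ ∧ ∀ (y : Γ) (n : ℕ) (S : Finset Γ), (∀ x ∈ S, G.dist y x ≤ n) →
      (S.card : ℝ) ≤ κ * (1 + n) ^ d := by
  obtain ⟨κ, hκ⟩ := hd
  refine ⟨max κ 1, le_max_right _ _, fun y n S hS => ?_⟩
  obtain ⟨hf, hc⟩ := hκ y (n + 1) (by omega)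
  have h1 : S.card ≤ {x : Γ | G.dist x y ≤ n + 1}.ncard := by
    rw [← Set.ncard_coe_finset]
    refine Set.ncard_le_ncard (fun x hx => ?_) hf
    have := hS x hx
    rw [SimpleGraph.dist_comm] at this
    exact this.trans (Nat.le_succ n)
  calc (S.card : ℝ) ≤ κ * ((n + 1 : ℕ) : ℝ) ^ d := (Nat.cast_le.2 h1).trans hc
    _ ≤ max κ 1 * ((n + 1 : ℕ) : ℝ) ^ d := by gcongr; exact le_max_left _ _
    _ = _ := by push_cast; rw [add_comm (n : ℝ)]

theorem card_nbhd_le [DecidableEq Γ] {d : ℕ} {κ : ℝ} (hκ : ∀ (y : Γ) (n : ℕ) (S : Finset Γ),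
    (∀ x ∈ S, G.dist y x ≤ n) → (S.card : ℝ) ≤ κ * (1 + n) ^ d) (Λ X : Finset Γ) (n : ℕ) :
    ((nbhd G Λ X n).card : ℝ) ≤ X.card * (κ * (1 + n) ^ d) := by
  have h1 : nbhd G Λ X n = X.biUnion fun x => {z ∈ Λ | G.dist x z ≤ n} := by
    ext z
    simp only [mem_nbhd, Finset.mem_biUnion, Finset.mem_filter]
    tauto
  calc ((nbhd G Λ X n).card : ℝ)
      ≤ ∑ x ∈ X, ((({z ∈ Λ | G.dist x z ≤ n} : Finset Γ).card : ℕ) : ℝ) := by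
        rw [h1]; exact_mod_cast Finset.card_biUnion_le
    _ ≤ ∑ x ∈ X, κ * (1 + n) ^ d :=
        Finset.sum_le_sum fun x _ => hκ x n _ fun z hz => (Finset.mem_filter.1 hz).2
    _ = _ := by simp

/-- Exponentials of the distance are summable, uniformly in the base point. -/
theorem exists_sum_exp_le {d : ℕ} (hd : IsDimensional G d) {ν : ℝ} (hν : 0 < ν) :
    ∃ S : ℝ, 0 < S ∧ ∀ (x : Γ) (Λ : Finset Γ), ∑ z ∈ Λ, Real.exp (-ν * G.dist x z) ≤ S := by
  obtain ⟨κ, hκ1, hκ⟩ := exists_ball_le hd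
  have hsum : Summable fun n : ℕ => κ * (1 + n : ℝ) ^ d * Real.exp (-ν * n) := by
    have h1 := ((summable_nat_add_iff 1).2 (Real.summable_pow_mul_exp_neg_nat_mul d hν)).mul_left
      (κ * Real.exp ν)
    refine h1.congr fun n => ?_
    have : Real.exp (-ν * n) = Real.exp ν * Real.exp (-ν * ((n + 1 : ℕ) : ℝ)) := by
      rw [← Real.exp_add]; push_cast; ring_nf
    rw [this]; push_cast; ring
  refine ⟨∑' n : ℕ, κ * (1 + n : ℝ) ^ d * Real.exp (-ν * n), ?_, fun x Λ => ?_⟩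
  · exact hsum.tsum_pos (fun n => by positivity) 0 (by positivity)
  · rw [← Finset.sum_fiberwise_of_maps_to (t := Λ.image fun z => G.dist x z)
      (g := fun z => G.dist x z) (fun z hz => Finset.mem_image_of_mem _ hz)]
    refine le_trans (Finset.sum_le_sum fun n _ => ?_)
      (hsum.sum_le_tsum (Λ.image fun z => G.dist x z) fun n _ => by positivity)
    calc ∑ z ∈ Λ with G.dist x z = n, Real.exp (-ν * G.dist x z)
        = ∑ z ∈ Λ with G.dist x z = n, Real.exp (-ν * n) :=
          Finset.sum_congr rfl fun z hz => by rw [(Finset.mem_filter.1 hz).2]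
      _ = (({z ∈ Λ | G.dist x z = n} : Finset Γ).card : ℝ) * Real.exp (-ν * n) := by simp
      _ ≤ _ := by
        gcongr
        exact hκ x n _ fun z hz => (Finset.mem_filter.1 hz).2.le

/-- A weight that varies by at most the factor `e^{ν dist}` is reproduced by terms with pair sums
bounded by `e^{-2ν dist}`. -/
theorem sum_mul_weight_le [DecidableEq Γ] {S : Finset (Finset Γ)} {Λ : Finset Γ}
    (hS : S ⊆ Λ.powerset)
    {f : Finset Γ → ℝ} {ν C s : ℝ} (hC : 0 ≤ C)
    (hf : ∀ x z, ∑ Z ∈ S with x ∈ Z ∧ z ∈ Z, f Z ≤ C * Real.exp (-(2 * ν) * G.dist x z))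
    (hs : ∀ x, ∑ z ∈ Λ, Real.exp (-ν * G.dist x z) ≤ s) {w : Γ → ℝ} (hw0 : ∀ x, 0 ≤ w x)
    (hw : ∀ x z, w z ≤ w x * Real.exp (ν * G.dist x z)) (x : Γ) :
    ∑ Z ∈ S with x ∈ Z, f Z * ∑ z ∈ Z, w z ≤ C * s * w x := by
  have h1 : ∀ Z ∈ S, f Z * ∑ z ∈ Z, w z = ∑ z ∈ Λ, if z ∈ Z then f Z * w z else 0 := by
    intro Z hZ
    rw [← Finset.sum_filter, Finset.mul_sum]
    refine Finset.sum_congr ?_ fun _ _ => rfl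
    ext z
    have := Finset.mem_powerset.1 (hS hZ)
    simp only [Finset.mem_filter]
    exact ⟨fun h => ⟨this h, h⟩, fun h => h.2⟩
  calc ∑ Z ∈ S with x ∈ Z, f Z * ∑ z ∈ Z, w z
      = ∑ z ∈ Λ, ∑ Z ∈ S with x ∈ Z, if z ∈ Z then f Z * w z else 0 := by
        rw [Finset.sum_comm]
        exact Finset.sum_congr rfl fun Z hZ => h1 Z (Finset.mem_filter.1 hZ).1
    _ = ∑ z ∈ Λ, (∑ Z ∈ S with x ∈ Z ∧ z ∈ Z, f Z) * w z := by
        refine Finset.sum_congr rfl fun z _ => ?_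
        rw [← Finset.sum_filter, Finset.filter_filter, Finset.sum_mul]
    _ ≤ ∑ z ∈ Λ, C * Real.exp (-(2 * ν) * G.dist x z) * (w x * Real.exp (ν * G.dist x z)) := by
        refine Finset.sum_le_sum fun z _ => ?_
        exact mul_le_mul (hf x z) (hw x z) (hw0 z) (by positivity)
    _ = C * (∑ z ∈ Λ, Real.exp (-ν * G.dist x z)) * w x := by
        rw [Finset.mul_sum, Finset.sum_mul]
        refine Finset.sum_congr rfl fun z _ => ?_
        have : Real.exp (-ν * G.dist x z) =
            Real.exp (-(2 * ν) * G.dist x z) * Real.exp (ν * G.dist x z) := by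
          rw [← Real.exp_add]; ring_nf
        rw [this]; ring
    _ ≤ _ := by
        have := hw0 x
        gcongr
        exact hs x

end Neighbourhood

/-! ### Decomposition of a time average into local layers -/

section Layers

variable {Γ : Type*} [DecidableEq Γ] {q : Γ → ℕ} {G : SimpleGraph Γ}

/-- The time average of the observable `A` on `X` under the dynamics of the volume `Y`. -/
noncomputable def localAverage (W : ℝ → ℝ) (φ : (Z : Finset Γ) → Obs q Z) {X : Finset Γ}
    (A : Obs q X) (Y : Finset Γ) : Obs q Y :=
  timeAverage W (localHam φ Y) (extend Y A)

/-- The change of the time average of `A` when the volume of the dynamics grows from the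
`(n - 1)`-neighbourhood of the support `X` of `A` to the `n`-neighbourhood. -/
noncomputable def layer (G : SimpleGraph Γ) (W : ℝ → ℝ) (φ : (Z : Finset Γ) → Obs q Z)
    (Λ : Finset Γ) {X : Finset Γ} (A : Obs q X) : (n : ℕ) → Obs q (nbhd G Λ X n)
  | 0 => localAverage W φ A _
  | n + 1 => localAverage W φ A _ - extend _ (localAverage W φ A (nbhd G Λ X n))

theorem extend_timeAverage {W : ℝ → ℝ} (hW : Integrable W) {Y Z : Finset Γ} (h : Y ⊆ Z)
    {H : Obs q Y} (hH : IsSelfAdjoint H) (A : Obs q Y) :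
    extend Z (timeAverage W H A) = timeAverage W (extend Z H) (extend Z A) := by
  rw [extend_of_subset h, timeAverage, timeAverage, ← embedCLM_apply,
    ← (embedCLM h).integral_comp_comm (integrable_smul_evolve hW hH A)]
  simp only [map_smul, embedCLM_apply, ← extend_of_subset h, extend_evolve h]

theorem extend_localAverage {W : ℝ → ℝ} (hW : Integrable W) {φ : (Z : Finset Γ) → Obs q Z}
    (hφ : ∀ Z, IsSelfAdjoint (φ Z)) {X Y Z : Finset Γ} (hX : X ⊆ Y) (h : Y ⊆ Z) (A : Obs q X) :
    extend Z (localAverage W φ A Y) =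
      timeAverage W (∑ V ∈ Y.powerset, extend Z (φ V)) (extend Z A) := by
  rw [localAverage, extend_timeAverage hW h (isSelfAdjoint_localHam hφ Y), extend_localHam φ h,
    extend_extend hX h]

theorem isSelfAdjoint_layer (W : ℝ → ℝ) {φ : (Z : Finset Γ) → Obs q Z}
    (hφ : ∀ Z, IsSelfAdjoint (φ Z)) (Λ : Finset Γ) {X : Finset Γ} {A : Obs q X}
    (hA : IsSelfAdjoint A) (n : ℕ) : IsSelfAdjoint (layer G W φ Λ A n) := by
  have h : ∀ Y, IsSelfAdjoint (localAverage W φ A Y) := fun Y =>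
    isSelfAdjoint_timeAverage W (isSelfAdjoint_localHam hφ Y) (isSelfAdjoint_extend Y hA)
  cases n with
  | zero => exact h _
  | succ n => exact (h _).sub (isSelfAdjoint_extend _ (h _))

theorem sum_extend_layer {W : ℝ → ℝ} (hW : Integrable W) {φ : (Z : Finset Γ) → Obs q Z}
    (hφ : ∀ Z, IsSelfAdjoint (φ Z)) {Λ X : Finset Γ} (hX : X ⊆ Λ) (A : Obs q X) :
    ∑ n ∈ Finset.range (volumeDiam G Λ + 1), extend Λ (layer G W φ Λ A n) =
      localAverage W φ A Λ := by
  have h1 : ∀ n, ∑ k ∈ Finset.range (n + 1), extend Λ (layer G W φ Λ A k) =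
      extend Λ (localAverage W φ A (nbhd G Λ X n)) := by
    intro n
    induction n with
    | zero => simp [layer]
    | succ n ih =>
      have h2 : extend Λ (layer G W φ Λ A (n + 1)) =
          extend Λ (localAverage W φ A (nbhd G Λ X (n + 1))) -
            extend Λ (localAverage W φ A (nbhd G Λ X n)) := by
        rw [layer, extend_of_subset (nbhd_subset Λ X (n + 1)), embed_sub,
          ← extend_of_subset, ← extend_of_subset (nbhd_subset Λ X (n + 1)),
          extend_extend (nbhd_mono Λ X n) (nbhd_subset Λ X (n + 1))]
      rw [Finset.sum_range_succ, ih, h2]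
      abel
  rw [h1]
  rcases X.eq_empty_or_nonempty with rfl | hne
  · -- scalars do not evolve
    have hc : ∀ Z, Commute (extend Λ A) (extend Λ (φ Z)) := fun Z =>
      commute_extend Λ (Finset.disjoint_empty_right Z) A (φ Z)
    rw [extend_localAverage hW hφ (Finset.empty_subset _) (nbhd_subset Λ ∅ _), localAverage,
      localHam, timeAverage, timeAverage]
    refine integral_congr_ae (Filter.Eventually.of_forall fun t => ?_)
    simp only
    rw [evolve_of_commute (Commute.sum_right _ _ _ fun Z _ => hc Z),
      evolve_of_commute (Commute.sum_right _ _ _ fun Z _ => hc Z)]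
  · rw [nbhd_volumeDiam hX hne, extend_of_subset (Finset.Subset.refl Λ), embed_self]

/-- The dynamics of two successive neighbourhoods of `X` differ only once a signal has crossed the
smaller one. -/
theorem norm_layer_le {W : ℝ → ℝ} (hW : Integrable W) {φ : (Z : Finset Γ) → Obs q Z}
    (hφ : ∀ Z, IsSelfAdjoint (φ Z)) (hG : G.Connected) {Λ : Finset Γ} {ν C s : ℝ} (hν : 0 < ν)
    (hC : 0 < C) (hs0 : 0 < s)
    (hf : ∀ x z, ∑ Z ∈ Λ.powerset with x ∈ Z ∧ z ∈ Z, ‖φ Z‖ ≤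
      C * Real.exp (-(2 * ν) * G.dist x z))
    (hs : ∀ x, ∑ z ∈ Λ, Real.exp (-ν * G.dist x z) ≤ s) {X : Finset Γ} (hX : X ⊆ Λ)
    (hne : X.Nonempty) (A : Obs q X) (n : ℕ) :
    ‖layer G W φ Λ A n‖ ≤ X.card * ‖A‖ * tailWeight W (4 * (C * s)) ν n := by
  have hcard : (1 : ℝ) ≤ X.card := by exact_mod_cast hne.card_pos
  have hM : 0 < C * s := mul_pos hC hs0
  cases n with
  | zero =>
    rw [layer, localAverage, timeAverage, tailWeight, ← integral_const_mul]
    refine norm_integral_le_of_norm_le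
      ((integrable_tailWeight hW _ ν _).const_mul _) (Filter.Eventually.of_forall fun t => ?_)
    rw [norm_smul, norm_evolve (isSelfAdjoint_localHam hφ _), Complex.norm_real, Real.norm_eq_abs]
    have h1 : (1 : ℝ) ≤ min 2 (Real.exp (4 * (C * s) * |t| - ν * (0 : ℕ))) := by
      refine le_min one_le_two (Real.one_le_exp ?_)
      simp only [Nat.cast_zero, mul_zero, sub_zero]
      positivity
    calc |W t| * ‖extend (nbhd G Λ X 0) A‖ ≤ |W t| * ‖A‖ := by
          gcongr; exact norm_extend_le _ _
      _ = 1 * ‖A‖ * (|W t| * 1) := by ring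
      _ ≤ _ := by gcongr
  | succ n =>
    set Y := nbhd G Λ X (n + 1) with hY
    have hXY : X ⊆ Y := subset_nbhd hX (n + 1)
    set a := extend Y A with ha
    have sa : ∀ S : Finset (Finset Γ), IsSelfAdjoint (∑ Z ∈ S, extend Y (φ Z)) := fun S =>
      isSelfAdjoint_sum _ fun Z _ => isSelfAdjoint_extend Y (hφ Z)
    have hpow : (nbhd G Λ X n).powerset ⊆ Y.powerset :=
      Finset.powerset_mono.2 (nbhd_mono Λ X n)
    -- the weight `e^{ν (dist(z, X) - (n + 1))}`
    let D : Γ → ℕ := fun z => X.inf' hne fun x => G.dist x z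
    let w : Γ → ℝ := fun z => Real.exp (ν * (D z - ((n + 1 : ℕ) : ℝ)))
    have hDX : ∀ x ∈ X, D x = 0 := fun x hx => by
      have : D x ≤ G.dist x x := Finset.inf'_le _ hx
      simpa using this
    have hDlip : ∀ x z, D z ≤ D x + G.dist x z := fun x z => by
      obtain ⟨y, hy, hyD⟩ := Finset.exists_mem_eq_inf' hne fun y => G.dist y x
      calc D z ≤ G.dist y z := Finset.inf'_le _ hy
        _ ≤ G.dist y x + G.dist x z := hG.dist_triangle
        _ = _ := by rw [← hyD]
    have hwX : ∑ x ∈ X, w x = X.card * Real.exp (-(ν * ((n + 1 : ℕ) : ℝ))) := by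
      rw [Finset.sum_congr rfl fun x hx => show w x = Real.exp (-(ν * ((n + 1 : ℕ) : ℝ))) by
        simp only [w, hDX x hx]; congr 1; push_cast; ring]
      simp
    have hdiff : ∀ t, ‖evolve (∑ Z ∈ Y.powerset, extend Y (φ Z)) t a -
        evolve (∑ Z ∈ (nbhd G Λ X n).powerset, extend Y (φ Z)) t a‖ ≤
        X.card * ‖A‖ * min 2 (Real.exp (4 * (C * s) * |t| - ν * ((n + 1 : ℕ) : ℝ))) := by
      intro t
      have hAa : ‖a‖ ≤ ‖A‖ := norm_extend_le Y A
      rw [mul_min_of_nonneg _ _ (by positivity)]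
      refine le_min ?_ ?_
      · refine (norm_sub_le _ _).trans ?_
        rw [norm_evolve (sa _), norm_evolve (sa _)]
        nlinarith [norm_nonneg A]
      · rw [norm_sub_rev]
        have key := norm_evolve_sum_sub_le hpow (h := fun Z => extend Y (φ Z))
          (fun Z _ => isSelfAdjoint_extend Y (hφ Z))
          (fun Z _ Z' _ hd => commute_extend Y hd _ _) (w := w)
          (c := Real.exp (ν * (0 - ((n + 1 : ℕ) : ℝ)))) (Real.exp_pos _)
          (fun x => Real.exp_le_exp.2 (by gcongr; positivity)) ?_ hM ?_ hne
          (fun Z _ hd => commute_extend Y hd A (φ Z)) t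
        · refine key.trans ?_
          rw [hwX]
          calc ‖a‖ * (X.card * Real.exp (-(ν * ((n + 1 : ℕ) : ℝ)))) *
                Real.exp (4 * (C * s) * |t|)
              = X.card * ‖a‖ * (Real.exp (4 * (C * s) * |t|) *
                Real.exp (-(ν * ((n + 1 : ℕ) : ℝ)))) := by ring
            _ = X.card * ‖a‖ * Real.exp (4 * (C * s) * |t| - ν * ((n + 1 : ℕ) : ℝ)) := by
              rw [← Real.exp_add, sub_eq_add_neg]
            _ ≤ _ := by gcongr
        · intro Z hZ hZ'
          rw [Finset.mem_powerset] at hZ hZ'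
          obtain ⟨z, hzZ, hz⟩ := Finset.not_subset.1 hZ'
          have hD : n + 1 ≤ D z := by
            refine Finset.le_inf' hne _ fun x hx => ?_
            by_contra hlt
            exact hz (mem_nbhd.2 ⟨nbhd_subset _ _ _ (hZ hzZ), x, hx, by omega⟩)
          calc 1 ≤ w z := by
                refine Real.one_le_exp (mul_nonneg hν.le (sub_nonneg.2 ?_))
                exact_mod_cast hD
            _ ≤ _ := Finset.single_le_sum (f := w) (fun y _ => (Real.exp_pos _).le) hzZ
        · have hYΛ : Y.powerset ⊆ Λ.powerset := Finset.powerset_mono.2 (nbhd_subset _ _ _)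
          refine sum_mul_weight_le (G := G) (ν := ν) hYΛ hC.le (fun x z => le_trans ?_ (hf x z)) hs
            (fun x => (Real.exp_pos _).le) fun x z => ?_
          · calc ∑ Z ∈ Y.powerset with x ∈ Z ∧ z ∈ Z, ‖extend Y (φ Z)‖
                ≤ ∑ Z ∈ Y.powerset with x ∈ Z ∧ z ∈ Z, ‖φ Z‖ :=
                  Finset.sum_le_sum fun Z _ => norm_extend_le Y _
              _ ≤ _ := Finset.sum_le_sum_of_subset_of_nonneg
                  (Finset.filter_subset_filter _ hYΛ) fun _ _ _ => norm_nonneg _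
          · simp only [w]
            rw [← Real.exp_add, Real.exp_le_exp, ← mul_add]
            gcongr
            have : (D z : ℝ) ≤ D x + G.dist x z := by exact_mod_cast hDlip x z
            linarith
    rw [layer, extend_localAverage hW hφ (subset_nbhd hX n) (nbhd_mono Λ X n), localAverage,
      ← hY, ← ha, localHam, timeAverage, timeAverage,
      ← integral_sub (integrable_smul_evolve hW (sa _) a) (integrable_smul_evolve hW (sa _) a),
      tailWeight, ← integral_const_mul]
    refine norm_integral_le_of_norm_le
      ((integrable_tailWeight hW _ ν _).const_mul _) (Filter.Eventually.of_forall fun t => ?_)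
    rw [← smul_sub, norm_smul, Complex.norm_real, Real.norm_eq_abs]
    calc _ ≤ |W t| * (X.card * ‖A‖ *
          min 2 (Real.exp (4 * (C * s) * |t| - ν * ((n + 1 : ℕ) : ℝ)))) := by
          gcongr; exact hdiff t
      _ = _ := by ring

end Layers

/-! ### Rapidly decaying functions -/

section Decay

theorem isFastDecaying_exp {μ : ℝ} (hμ : 0 < μ) : IsFastDecaying fun r => Real.exp (-μ * r) where
  pos _ _ := Real.exp_pos _
  bounded := ⟨1, by
    rintro _ ⟨r, hr, rfl⟩
    exact Real.exp_le_one_iff.2 (by nlinarith [Set.mem_Ici.1 hr])⟩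
  antitone r _ s _ hrs := Real.exp_le_exp.2 (by nlinarith)
  superadditive r s _ _ := by rw [← Real.exp_add]; ring_nf; rfl
  fast n := by
    refine ⟨n.factorial / μ ^ n, ?_⟩
    rintro _ ⟨r, hr, rfl⟩
    have h := Real.pow_div_factorial_le_exp (x := μ * r) (mul_nonneg hμ.le hr) n
    rw [div_le_iff₀ (by positivity), mul_pow] at h
    rw [le_div_iff₀ (by positivity)]
    calc r ^ n * Real.exp (-μ * r) * μ ^ n = Real.exp (-μ * r) * (μ ^ n * r ^ n) := by ring
      _ ≤ Real.exp (-μ * r) * (Real.exp (μ * r) * n.factorial) := by gcongr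
      _ = n.factorial := by rw [← mul_assoc, ← Real.exp_add]; simp

/-- The function `∏ₖ (1 + r / aₖ)⁻¹`, written as an exponential. Its logarithm is subadditive
because `r ↦ log (1 + r / a)` is, and it decays faster than any power because the product has
infinitely many factors; the faster `a` grows, the slower is the decay. -/
noncomputable def productDecay (a : ℕ → ℝ) (r : ℝ) : ℝ := Real.exp (-∑' k, Real.log (1 + r / a k))

variable {a : ℕ → ℝ}

theorem log_one_add_div_le (ha : ∀ k, 2 ^ k ≤ a k) {r : ℝ} (hr : 0 ≤ r) (k : ℕ) :
    Real.log (1 + r / a k) ≤ r * (1 / 2) ^ k := by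
  have h2 : (0 : ℝ) < 2 ^ k := by positivity
  have h0 : 0 < a k := h2.trans_le (ha k)
  have h1 := Real.log_le_sub_one_of_pos (show 0 < 1 + r / a k by positivity)
  calc Real.log (1 + r / a k) ≤ r / a k := by linarith
    _ ≤ r / 2 ^ k := by gcongr; exact ha k
    _ = _ := by simp [div_eq_mul_inv]

theorem log_one_add_div_nonneg (ha : ∀ k, 2 ^ k ≤ a k) {r : ℝ} (hr : 0 ≤ r) (k : ℕ) :
    0 ≤ Real.log (1 + r / a k) := by
  have h0 : 0 < a k := lt_of_lt_of_le (by positivity) (ha k)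
  exact Real.log_nonneg (by linarith [div_nonneg hr h0.le])

theorem summable_log_one_add_div (ha : ∀ k, 2 ^ k ≤ a k) {r : ℝ} (hr : 0 ≤ r) :
    Summable fun k => Real.log (1 + r / a k) :=
  Summable.of_nonneg_of_le (log_one_add_div_nonneg ha hr) (log_one_add_div_le ha hr)
    ((summable_geometric_of_lt_one (by norm_num) (by norm_num)).mul_left r)

theorem isFastDecaying_productDecay (ha : ∀ k, 2 ^ k ≤ a k) : IsFastDecaying (productDecay a) where
  pos _ _ := Real.exp_pos _
  bounded := ⟨1, by
    rintro _ ⟨r, hr, rfl⟩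
    exact Real.exp_le_one_iff.2 (neg_nonpos.2 (tsum_nonneg (log_one_add_div_nonneg ha hr)))⟩
  antitone r hr s hs hrs := by
    refine Real.exp_le_exp.2 (neg_le_neg ?_)
    refine (summable_log_one_add_div ha hr).tsum_le_tsum (fun k => ?_)
      (summable_log_one_add_div ha hs)
    have h0 : 0 < a k := lt_of_lt_of_le (by positivity) (ha k)
    have hr' : 0 ≤ r := hr
    gcongr
  superadditive r s hr hs := by
    rw [productDecay, productDecay, productDecay, ← Real.exp_add, Real.exp_le_exp, ← neg_add,
      neg_le_neg_iff, ← (summable_log_one_add_div ha hr).tsum_add (summable_log_one_add_div ha hs)]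
    refine (summable_log_one_add_div ha (add_nonneg hr hs)).tsum_le_tsum (fun k => ?_)
      ((summable_log_one_add_div ha hr).add (summable_log_one_add_div ha hs))
    have h0 : 0 < a k := lt_of_lt_of_le (by positivity) (ha k)
    rw [← Real.log_mul (by positivity) (by positivity)]
    refine Real.log_le_log (by positivity) ?_
    have : 0 ≤ r / a k * (s / a k) := by positivity
    rw [add_div]
    linarith
  fast n := by
    refine ⟨∏ k ∈ Finset.range n, a k, ?_⟩
    rintro _ ⟨r, hr, rfl⟩
    have hr' : 0 ≤ r := hr
    have h0 : ∀ k, 0 < a k := fun k => lt_of_lt_of_le (by positivity) (ha k)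
    have h1 := (summable_log_one_add_div ha hr).sum_le_tsum (Finset.range n)
      fun k _ => log_one_add_div_nonneg ha hr k
    have h2 : Real.exp (∑ k ∈ Finset.range n, Real.log (1 + r / a k)) =
        ∏ k ∈ Finset.range n, (1 + r / a k) := by
      rw [Real.exp_sum]
      refine Finset.prod_congr rfl fun k _ => Real.exp_log ?_
      have := h0 k
      positivity
    have h3 : r ^ n ≤ (∏ k ∈ Finset.range n, a k) * ∏ k ∈ Finset.range n, (1 + r / a k) := by
      rw [← Finset.prod_mul_distrib]
      calc r ^ n = ∏ _k ∈ Finset.range n, r := by simp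
        _ ≤ _ := by
          refine Finset.prod_le_prod (fun _ _ => hr') fun k _ => ?_
          have := h0 k
          rw [mul_add, mul_div_cancel₀ _ this.ne']
          linarith
    have hA : 0 ≤ ∏ k ∈ Finset.range n, a k := Finset.prod_nonneg fun k _ => (h0 k).le
    calc r ^ n * productDecay a r
        ≤ (∏ k ∈ Finset.range n, a k) * Real.exp (∑' k, Real.log (1 + r / a k)) *
            productDecay a r := by
          refine mul_le_mul_of_nonneg_right (h3.trans ?_) (Real.exp_pos _).le
          rw [← h2]
          gcongr
      _ = _ := by rw [productDecay, mul_assoc, ← Real.exp_add]; simp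

/-- A function bounded by `C p * (1 + r) ^ (-p)` for all `p` is dominated by a member of the
class `𝓢`. -/
theorem exists_isFastDecaying_ge {C : ℕ → ℝ} (hC : ∀ p, 0 ≤ C p) :
    ∃ ζ, IsFastDecaying ζ ∧ ∃ K, 0 < K ∧ ∀ r, 0 ≤ r → ∃ p, C p * ((1 + r) ^ p)⁻¹ ≤ K * ζ r := by
  -- beyond `b (k - 1)` the bound with `p = k + 1` is below `(1 + r) ^ (-k)`
  let b : ℕ → ℝ := fun k => 1 + k + ∑ j ∈ Finset.range (k + 3), C j
  have hb1 : ∀ k, 1 ≤ b k := fun k => by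
    have := Finset.sum_nonneg fun j (_ : j ∈ Finset.range (k + 3)) => hC j
    have : (0 : ℝ) ≤ k := by positivity
    simp only [b]; linarith
  have hbC : ∀ k, C (k + 2) ≤ b k := fun k => by
    have h1 := Finset.single_le_sum (fun j _ => hC j)
      (Finset.mem_range.2 (show k + 2 < k + 3 by omega))
    have : (0 : ℝ) ≤ k := by positivity
    simp only [b]; linarith
  have hmono : Monotone b := fun k l hkl => by
    have h1 : ∑ j ∈ Finset.range (k + 3), C j ≤ ∑ j ∈ Finset.range (l + 3), C j :=
      Finset.sum_le_sum_of_subset_of_nonneg (Finset.range_mono (by omega)) fun j _ _ => hC j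
    have : (k : ℝ) ≤ l := by exact_mod_cast hkl
    simp only [b]; linarith
  have hbk : ∀ k : ℕ, (k : ℝ) < b k := fun k => by
    have := Finset.sum_nonneg fun j (_ : j ∈ Finset.range (k + 3)) => hC j
    simp only [b]; linarith
  let a : ℕ → ℝ := fun k => 2 ^ k * b k
  have ha : ∀ k, 2 ^ k ≤ a k := fun k => le_mul_of_one_le_right (by positivity) (hb1 k)
  refine ⟨productDecay a, isFastDecaying_productDecay ha, (1 + C 0) * Real.exp 2,
    mul_pos (by linarith [hC 0]) (Real.exp_pos 2), fun r hr => ?_⟩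
  have hex : ∃ m : ℕ, r < b m := by
    obtain ⟨m, hm⟩ := exists_nat_gt r
    exact ⟨m, hm.trans (hbk m)⟩
  classical
  obtain ⟨m, hm, hmin⟩ : ∃ m : ℕ, r < b m ∧ ∀ k < m, b k ≤ r :=
    ⟨Nat.find hex, Nat.find_spec hex, fun k hk => not_lt.1 (Nat.find_min hex hk)⟩
  have hterm : ∀ k, Real.log (1 + r / a k) ≤
      (if k < m then Real.log (1 + r) else 0) + (1 / 2) ^ k := by
    intro k
    have h0 : 0 < a k := lt_of_lt_of_le (by positivity) (ha k)
    have hp : (0 : ℝ) < (1 / 2) ^ k := by positivity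
    split_ifs with hk
    · have h1 : r / a k ≤ r := div_le_self hr ((one_le_pow₀ one_le_two).trans (ha k))
      have : Real.log (1 + r / a k) ≤ Real.log (1 + r) :=
        Real.log_le_log (by positivity) (by linarith)
      linarith
    · have h1 := Real.log_le_sub_one_of_pos (show 0 < 1 + r / a k by positivity)
      have h2 : r / a k ≤ (1 / 2) ^ k := by
        have h3 : r ≤ b k := hm.le.trans (hmono (not_lt.1 hk))
        rw [div_le_iff₀ h0]
        calc r ≤ b k := h3
          _ = (1 / 2) ^ k * a k := by
            simp only [a]; rw [← mul_assoc, ← mul_pow]; norm_num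
      linarith
  have hfin : Summable fun k => if k < m then Real.log (1 + r) else 0 :=
    summable_of_ne_finset_zero (s := Finset.range m) fun k hk => by
      simp only [Finset.mem_range] at hk
      simp [hk]
  have hgeo : Summable fun k : ℕ => ((1 : ℝ) / 2) ^ k :=
    summable_geometric_of_lt_one (by norm_num) (by norm_num)
  have hsum : ∑' k, Real.log (1 + r / a k) ≤ m * Real.log (1 + r) + 2 := by
    refine ((summable_log_one_add_div ha hr).tsum_le_tsum hterm (hfin.add hgeo)).trans ?_
    rw [hfin.tsum_add hgeo, tsum_geometric_two,
      tsum_eq_sum (s := Finset.range m) fun k hk => by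
        simp only [Finset.mem_range] at hk
        simp [hk],
      Finset.sum_congr rfl fun k hk => if_pos (Finset.mem_range.1 hk)]
    simp
  have hζ : ((1 + r) ^ m)⁻¹ ≤ Real.exp 2 * productDecay a r := by
    rw [productDecay, ← Real.exp_add]
    calc ((1 + r) ^ m)⁻¹ = Real.exp (-(m * Real.log (1 + r))) := by
          rw [Real.exp_neg, Real.exp_nat_mul, Real.exp_log (by linarith)]
      _ ≤ _ := Real.exp_le_exp.2 (by linarith)
  have hC0 := hC 0
  rcases m with _ | m
  · refine ⟨0, ?_⟩
    calc C 0 * ((1 + r) ^ 0)⁻¹ ≤ (1 + C 0) * ((1 + r) ^ 0)⁻¹ := by gcongr; linarith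
      _ ≤ (1 + C 0) * (Real.exp 2 * productDecay a r) := by gcongr
      _ = _ := by ring
  · refine ⟨m + 2, ?_⟩
    have h1 : C (m + 2) ≤ 1 + r := ((hbC m).trans (hmin m (Nat.lt_succ_self m))).trans (by linarith)
    calc C (m + 2) * ((1 + r) ^ (m + 2))⁻¹ ≤ (1 + r) * ((1 + r) ^ (m + 2))⁻¹ := by gcongr
      _ = ((1 + r) ^ (m + 1))⁻¹ := by
        have : 1 + r ≠ 0 := by linarith
        rw [pow_succ (1 + r) (m + 1)]; field_simp
      _ ≤ 1 * (Real.exp 2 * productDecay a r) := by rw [one_mul]; exact hζ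
      _ ≤ (1 + C 0) * (Real.exp 2 * productDecay a r) := by
        have := (isFastDecaying_productDecay ha).pos r hr
        gcongr; linarith
      _ = _ := by ring

theorem decay_pos {ζ : ℝ → ℝ} (hζ : IsFastDecaying ζ) (d : ℕ) {r : ℝ} (hr : 0 ≤ r) :
    0 < decay d ζ r := mul_pos (hζ.pos r hr) (by positivity)

theorem decay_le {ζ : ℝ → ℝ} (hζ : IsFastDecaying ζ) (d : ℕ) {r : ℝ} (hr : 0 ≤ r) :
    decay d ζ r ≤ ζ r :=
  mul_le_of_le_one_right (hζ.pos r hr).le (inv_le_one_of_one_le₀ (one_le_pow₀ (by linarith)))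

theorem exists_decay_mul_pow_le {ζ : ℝ → ℝ} (hζ : IsFastDecaying ζ) (d p : ℕ) :
    ∃ c, 0 ≤ c ∧ ∀ r, 0 ≤ r → decay d ζ r * (1 + r) ^ p ≤ c := by
  obtain ⟨c₀, hc₀⟩ := hζ.bounded
  obtain ⟨c₁, hc₁⟩ := hζ.fast p
  have h₀ : ∀ r, 0 ≤ r → ζ r ≤ c₀ := fun r hr => hc₀ ⟨r, hr, rfl⟩
  have h₁ : ∀ r, 0 ≤ r → r ^ p * ζ r ≤ c₁ := fun r hr => hc₁ ⟨r, hr, rfl⟩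
  have hc₀' : 0 ≤ c₀ := (hζ.pos 0 le_rfl).le.trans (h₀ 0 le_rfl)
  have hc₁' : 0 ≤ c₁ :=
    (mul_nonneg (by positivity) (hζ.pos 1 zero_le_one).le).trans (h₁ 1 zero_le_one)
  refine ⟨2 ^ p * (c₀ + c₁), by positivity, fun r hr => ?_⟩
  have hz := (hζ.pos r hr).le
  calc decay d ζ r * (1 + r) ^ p ≤ ζ r * (1 + r) ^ p := by gcongr; exact decay_le hζ d hr
    _ ≤ 2 ^ p * (c₀ + c₁) := by
      rcases le_total r 1 with h | h
      · calc ζ r * (1 + r) ^ p ≤ c₀ * 2 ^ p := by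
              gcongr
              · exact h₀ r hr
              · linarith
          _ ≤ _ := by nlinarith [show (0 : ℝ) < 2 ^ p by positivity]
      · calc ζ r * (1 + r) ^ p ≤ ζ r * (2 * r) ^ p := by gcongr; linarith
          _ = 2 ^ p * (r ^ p * ζ r) := by rw [mul_pow]; ring
          _ ≤ 2 ^ p * (c₀ + c₁) := by gcongr; linarith [h₁ r hr]

end Decay

/-! ### Pair sums of interactions -/

section PairSum

variable {Γ : Type*} [DecidableEq Γ] {q : Γ → ℕ} {G : SimpleGraph Γ}

/-- The norm of the term of `Z`, uniformly in time. -/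
noncomputable def supNorm (Φ : Terms q) (Λ Z : Finset Γ) : ℝ≥0∞ :=
  ⨆ s ∈ Set.Icc (0 : ℝ) 1, ‖Φ Λ s Z‖ₑ

/-- The sum over `Z ∋ x, y` in the interaction norm, without the division by `F_ζ`. -/
noncomputable def pairSum (n : ℤ) (Φ : Terms q) (Λ : Finset Γ) (x y : Γ) : ℝ≥0∞ :=
  ∑ Z ∈ Λ.powerset with x ∈ Z ∧ y ∈ Z, ENNReal.ofReal ((Z.card : ℝ) ^ n) * supNorm Φ Λ Z

theorem enorm_le_supNorm (Φ : Terms q) (Λ Z : Finset Γ) {s : ℝ} (hs : s ∈ Set.Icc (0 : ℝ) 1) :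
    ‖Φ Λ s Z‖ₑ ≤ supNorm Φ Λ Z := le_iSup₂ (f := fun s _ => ‖Φ Λ s Z‖ₑ) s hs

theorem iSup_ofReal_eq (n : ℤ) (Φ : Terms q) (Λ Z : Finset Γ) {D : ℝ} (hD : 0 < D) :
    (⨆ s ∈ Set.Icc (0 : ℝ) 1, ENNReal.ofReal (((Z.card : ℝ) ^ n * ‖Φ Λ s Z‖) / D)) =
      ENNReal.ofReal ((Z.card : ℝ) ^ n) * supNorm Φ Λ Z / ENNReal.ofReal D := by
  simp only [supNorm, ENNReal.mul_iSup, ENNReal.iSup_div]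
  refine iSup_congr fun s => iSup_congr fun _ => ?_
  rw [ENNReal.ofReal_div_of_pos hD, ENNReal.ofReal_mul (by positivity), ofReal_norm]

theorem tsum_eq_pairSum_div (n : ℤ) {Φ : Terms q} (hΦ : IsInteraction Φ) (Λ : Finset Γ) (x y : Γ)
    {D : ℝ} (hD : 0 < D) :
    ∑' Z : {Z : Finset Γ // x ∈ Z ∧ y ∈ Z}, (⨆ s ∈ Set.Icc (0 : ℝ) 1,
      ENNReal.ofReal (((Z.1.card : ℝ) ^ n * ‖Φ Λ s Z.1‖) / D)) =
      pairSum n Φ Λ x y / ENNReal.ofReal D := by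
  simp only [iSup_ofReal_eq n Φ Λ _ hD]
  rw [show ∑' Z : {Z : Finset Γ // x ∈ Z ∧ y ∈ Z}, ENNReal.ofReal ((Z.1.card : ℝ) ^ n) *
      supNorm Φ Λ Z.1 / ENNReal.ofReal D = _ from
    tsum_subtype {Z : Finset Γ | x ∈ Z ∧ y ∈ Z} fun Z => ENNReal.ofReal ((Z.card : ℝ) ^ n) *
      supNorm Φ Λ Z / ENNReal.ofReal D, tsum_eq_sum (s := Λ.powerset), pairSum, Finset.sum_filter]
  · simp only [div_eq_mul_inv, Finset.sum_mul]
    refine Finset.sum_congr rfl fun Z _ => ?_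
    by_cases h : x ∈ Z ∧ y ∈ Z <;> simp [Set.indicator, h]
  · intro Z hZ
    rw [Finset.mem_powerset] at hZ
    have h0 : supNorm Φ Λ Z = 0 := by
      simp only [supNorm, ENNReal.iSup_eq_zero]
      intro s hs
      rw [hΦ.eq_zero Λ s hs Z hZ, enorm_zero]
    simp [Set.indicator, h0]

theorem interactionNorm_le_iff {d : ℕ} {ζ : ℝ → ℝ} (hζ : IsFastDecaying ζ) (n : ℤ) {Φ : Terms q}
    (hΦ : IsInteraction Φ) (C : ℝ≥0∞) :
    interactionNorm G d ζ n Φ ≤ C ↔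
      ∀ Λ x y, pairSum n Φ Λ x y ≤ C * ENNReal.ofReal (decay d ζ (G.dist x y)) := by
  simp only [interactionNorm, iSup_le_iff]
  refine forall₃_congr fun Λ x y => ?_
  have hD := decay_pos hζ d (Nat.cast_nonneg (G.dist x y))
  rw [tsum_eq_pairSum_div n hΦ Λ x y hD,
    ENNReal.div_le_iff (by simpa using hD) ENNReal.ofReal_ne_top]

/-- An interaction belongs to `𝓑_{𝓢,n}` as soon as its pair sums decay faster than any power of
the distance. -/
theorem memBS_of_pairSum_le {d : ℕ} {n : ℤ} {Φ : Terms q} (hΦ : IsInteraction Φ)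
    (h : ∀ p : ℕ, ∃ C : ℝ, 0 ≤ C ∧ ∀ Λ x y,
      pairSum n Φ Λ x y ≤ ENNReal.ofReal (C * ((1 + G.dist x y : ℝ) ^ p)⁻¹)) :
    MemBS G d n Φ := by
  choose C hC0 hC using h
  -- the shift by `d + 1` compensates the polynomial factor of `F_ζ`
  obtain ⟨ζ, hζ, K, hK, hp⟩ := exists_isFastDecaying_ge (C := fun p => C (p + (d + 1)))
    fun p => hC0 _
  refine ⟨ζ, hζ, hΦ, lt_of_le_of_lt ((interactionNorm_le_iff hζ n hΦ (ENNReal.ofReal K)).2 ?_)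
    ENNReal.ofReal_lt_top⟩
  intro Λ x y
  obtain ⟨p, hp⟩ := hp (G.dist x y) (Nat.cast_nonneg _)
  refine (hC (p + (d + 1)) Λ x y).trans ?_
  rw [← ENNReal.ofReal_mul hK.le]
  refine ENNReal.ofReal_le_ofReal ?_
  rw [decay, ← mul_assoc, pow_add, mul_inv, ← mul_assoc]
  gcongr

end PairSum

/-! ### The interaction of the averaged family -/

section AveragedInteraction

variable {Γ : Type*} [DecidableEq Γ] {q : Γ → ℕ} {G : SimpleGraph Γ}

/-- The interaction of `𝓘(B)`, for `B` with interaction `Ψ`: the term of `Z` collects all layers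
of terms `Ψ(X)` that belong to a neighbourhood of `X` equal to `Z`. -/
noncomputable def averagedTerms (G : SimpleGraph Γ) (W : ℝ → ℝ) (Φ Ψ : Terms q) : Terms q :=
  fun Λ s Z => ∑ X ∈ Λ.powerset, ∑ n ∈ Finset.range (volumeDiam G Λ + 1),
    if nbhd G Λ X n = Z then extend Z (layer G W (Φ Λ s) Λ (Ψ Λ s X) n) else 0

theorem isInteraction_averagedTerms (W : ℝ → ℝ) {Φ Ψ : Terms q} (hΦ : IsInteraction Φ)
    (hΨ : IsInteraction Ψ) : IsInteraction (averagedTerms G W Φ Ψ) where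
  selfAdjoint Λ s hs Z := by
    refine isSelfAdjoint_sum _ fun X _ => isSelfAdjoint_sum _ fun n _ => ?_
    split_ifs
    · exact isSelfAdjoint_extend Z
        (isSelfAdjoint_layer W (hΦ.selfAdjoint Λ s hs) Λ (hΨ.selfAdjoint Λ s hs X) n)
    · exact .zero _
  eq_zero Λ s _ Z hZ := by
    refine Finset.sum_eq_zero fun X _ => Finset.sum_eq_zero fun n _ => if_neg ?_
    rintro rfl
    exact hZ (nbhd_subset Λ X n)

theorem isAssociated_averagedTerms {W : ℝ → ℝ} (hW : Integrable W) {Φ Ψ : Terms q}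
    (hΦ : IsInteraction Φ) {B : OpFamily q} (hB : IsAssociated Ψ B) :
    IsAssociated (averagedTerms G W Φ Ψ) (spectralMap W (hamiltonian Φ) B) := by
  intro Λ s hs
  have hφ := hΦ.selfAdjoint Λ s hs
  calc spectralMap W (hamiltonian Φ) B Λ s
      = timeAverage W (localHam (Φ Λ s) Λ) (localHam (Ψ Λ s) Λ) := by
        rw [← hamiltonian_eq_localHam, ← hamiltonian_eq_localHam, ← hB Λ s hs]
        rfl
    _ = ∑ X ∈ Λ.powerset, localAverage W (Φ Λ s) (Ψ Λ s X) Λ := by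
        rw [show localHam (Ψ Λ s) Λ = ∑ X ∈ Λ.powerset, extend Λ (Ψ Λ s X) from rfl,
          timeAverage_sum _ hW (isSelfAdjoint_localHam hφ Λ)]
        rfl
    _ = ∑ X ∈ Λ.powerset, ∑ n ∈ Finset.range (volumeDiam G Λ + 1),
          extend Λ (layer G W (Φ Λ s) Λ (Ψ Λ s X) n) :=
        Finset.sum_congr rfl fun X hX =>
          (sum_extend_layer hW hφ (Finset.mem_powerset.1 hX) _).symm
    _ = ∑ X ∈ Λ.powerset, ∑ n ∈ Finset.range (volumeDiam G Λ + 1), ∑ Z ∈ Λ.powerset,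
          extend Λ (if nbhd G Λ X n = Z then
            extend Z (layer G W (Φ Λ s) Λ (Ψ Λ s X) n) else 0) := by
        refine Finset.sum_congr rfl fun X _ => Finset.sum_congr rfl fun n _ => ?_
        rw [Finset.sum_eq_single (nbhd G Λ X n)]
        · rw [if_pos rfl, extend_extend (Finset.Subset.refl _) (nbhd_subset Λ X n)]
        · intro Z _ hZ
          rw [if_neg hZ.symm, extend_zero]
        · intro h
          exact absurd (Finset.mem_powerset.2 (nbhd_subset Λ X n)) h
    _ = hamiltonian (averagedTerms G W Φ Ψ) Λ s := by
        rw [hamiltonian_eq_localHam, localHam]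
        simp only [averagedTerms, extend_sum]
        exact (Finset.sum_congr rfl fun X _ => Finset.sum_comm).trans Finset.sum_comm

theorem supNorm_averagedTerms_le {W : ℝ → ℝ} {Φ Ψ : Terms q} {η : ℕ → ℝ}
    (hη : ∀ Λ, ∀ s ∈ Set.Icc (0 : ℝ) 1, ∀ X ⊆ Λ, X.Nonempty → ∀ n,
      ‖layer G W (Φ Λ s) Λ (Ψ Λ s X) n‖ ≤ X.card * ‖Ψ Λ s X‖ * η n)
    {Λ Z : Finset Γ} (hZ : Z.Nonempty) :
    supNorm (averagedTerms G W Φ Ψ) Λ Z ≤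
      ∑ X ∈ Λ.powerset, ∑ n ∈ Finset.range (volumeDiam G Λ + 1),
        if nbhd G Λ X n = Z then X.card * supNorm Ψ Λ X * ENNReal.ofReal (η n) else 0 := by
  refine iSup₂_le fun s hs => (enorm_sum_le _ _).trans (Finset.sum_le_sum fun X hX =>
    (enorm_sum_le _ _).trans (Finset.sum_le_sum fun n _ => ?_))
  split_ifs with h
  · have hne : X.Nonempty := by
      by_contra hX
      rw [Finset.not_nonempty_iff_eq_empty] at hX
      rw [hX, nbhd_empty] at h
      exact hZ.ne_empty h.symm
    calc ‖extend Z (layer G W (Φ Λ s) Λ (Ψ Λ s X) n)‖ₑ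
        ≤ ENNReal.ofReal (X.card * ‖Ψ Λ s X‖ * η n) := by
          rw [← ofReal_norm]
          exact ENNReal.ofReal_le_ofReal ((norm_extend_le Z _).trans
            (hη Λ s hs X (Finset.mem_powerset.1 hX) hne n))
      _ = X.card * ‖Ψ Λ s X‖ₑ * ENNReal.ofReal (η n) := by
          rw [ENNReal.ofReal_mul (by positivity), ENNReal.ofReal_mul (by positivity),
            ENNReal.ofReal_natCast, ofReal_norm]
      _ ≤ _ := by gcongr; exact enorm_le_supNorm Ψ Λ X hs
  · simp

/-- The power of the support size lost or gained when passing to a neighbourhood. -/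
theorem card_zpow_le {m N : ℕ} {b : ℝ} (hm : 0 < m) (hmN : m ≤ N) (hb : 1 ≤ b)
    (hN : (N : ℝ) ≤ m * b) (k : ℤ) : (N : ℝ) ^ k ≤ (m : ℝ) ^ k * b ^ k.natAbs := by
  have hm' : (0 : ℝ) < m := by exact_mod_cast hm
  have hmN' : (m : ℝ) ≤ N := by exact_mod_cast hmN
  obtain ⟨j, rfl | rfl⟩ := k.eq_nat_or_neg
  · simp only [zpow_natCast, Int.natAbs_natCast]
    rw [← mul_pow]
    gcongr
  · simp only [zpow_neg, zpow_natCast, Int.natAbs_neg, Int.natAbs_natCast]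
    calc ((N : ℝ) ^ j)⁻¹ ≤ ((m : ℝ) ^ j)⁻¹ := by gcongr
      _ ≤ _ := le_mul_of_one_le_right (by positivity) (one_le_pow₀ hb)

/-- Pair sums over the sets whose `n`-neighbourhoods contain `x` and `y` reduce to pair sums over
the points of the `n`-balls around `x` and `y`. -/
theorem sum_nbhd_le (Λ : Finset Γ) (x y : Γ) (n : ℕ) (g : Finset Γ → ℝ≥0∞) :
    ∑ X ∈ Λ.powerset with x ∈ nbhd G Λ X n ∧ y ∈ nbhd G Λ X n, g X ≤
      ∑ x' ∈ Λ with G.dist x x' ≤ n, ∑ y' ∈ Λ with G.dist y y' ≤ n,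
        ∑ X ∈ Λ.powerset with x' ∈ X ∧ y' ∈ X, g X := by
  set Bx : Finset Γ := {x' ∈ Λ | G.dist x x' ≤ n}
  set By : Finset Γ := {y' ∈ Λ | G.dist y y' ≤ n}
  calc ∑ X ∈ Λ.powerset with x ∈ nbhd G Λ X n ∧ y ∈ nbhd G Λ X n, g X
      ≤ ∑ X ∈ Λ.powerset, ∑ x' ∈ Bx, ∑ y' ∈ By, if x' ∈ X ∧ y' ∈ X then g X else 0 := by
        rw [Finset.sum_filter]
        refine Finset.sum_le_sum fun X hX => ?_
        rw [Finset.mem_powerset] at hX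
        split_ifs with h
        · obtain ⟨-, x', hx', hdx⟩ := mem_nbhd.1 h.1
          obtain ⟨-, y', hy', hdy⟩ := mem_nbhd.1 h.2
          rw [SimpleGraph.dist_comm] at hdx hdy
          have hx'B : x' ∈ Bx := Finset.mem_filter.2 ⟨hX hx', hdx⟩
          have hy'B : y' ∈ By := Finset.mem_filter.2 ⟨hX hy', hdy⟩
          calc g X = if x' ∈ X ∧ y' ∈ X then g X else 0 := by simp [hx', hy']
            _ ≤ ∑ y' ∈ By, if x' ∈ X ∧ y' ∈ X then g X else 0 :=
              Finset.single_le_sum (f := fun y' => if x' ∈ X ∧ y' ∈ X then g X else 0)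
                (fun _ _ => zero_le) hy'B
            _ ≤ _ := Finset.single_le_sum
                (f := fun x' => ∑ y' ∈ By, if x' ∈ X ∧ y' ∈ X then g X else 0)
                (fun _ _ => zero_le) hx'B
        · exact zero_le
    _ = _ := by
        rw [Finset.sum_comm]
        refine Finset.sum_congr rfl fun x' _ => ?_
        rw [Finset.sum_comm]
        exact Finset.sum_congr rfl fun y' _ => (Finset.sum_filter _ _).symm

theorem pairSum_averagedTerms_le {W : ℝ → ℝ} {Φ Ψ : Terms q} {η : ℕ → ℝ} {d : ℕ} {κ : ℝ}
    (hκ1 : 1 ≤ κ) (hκ : ∀ (y : Γ) (n : ℕ) (S : Finset Γ), (∀ x ∈ S, G.dist y x ≤ n) →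
      (S.card : ℝ) ≤ κ * (1 + n) ^ d)
    (hη : ∀ Λ, ∀ s ∈ Set.Icc (0 : ℝ) 1, ∀ X ⊆ Λ, X.Nonempty → ∀ n,
      ‖layer G W (Φ Λ s) Λ (Ψ Λ s X) n‖ ≤ X.card * ‖Ψ Λ s X‖ * η n)
    (k : ℤ) (Λ : Finset Γ) (x y : Γ) :
    pairSum k (averagedTerms G W Φ Ψ) Λ x y ≤
      ∑ n ∈ Finset.range (volumeDiam G Λ + 1),
        ENNReal.ofReal (η n) * ENNReal.ofReal ((κ * (1 + n) ^ d) ^ k.natAbs) *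
          ∑ x' ∈ Λ with G.dist x x' ≤ n, ∑ y' ∈ Λ with G.dist y y' ≤ n,
            pairSum (k + 1) Ψ Λ x' y' := by
  set N := volumeDiam G Λ + 1
  calc pairSum k (averagedTerms G W Φ Ψ) Λ x y
      ≤ ∑ Z ∈ Λ.powerset with x ∈ Z ∧ y ∈ Z, ENNReal.ofReal ((Z.card : ℝ) ^ k) *
          ∑ X ∈ Λ.powerset, ∑ n ∈ Finset.range N,
            if nbhd G Λ X n = Z then X.card * supNorm Ψ Λ X * ENNReal.ofReal (η n) else 0 := by
        refine Finset.sum_le_sum fun Z hZ => ?_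
        gcongr
        exact supNorm_averagedTerms_le hη ⟨x, (Finset.mem_filter.1 hZ).2.1⟩
    _ = ∑ n ∈ Finset.range N, ∑ X ∈ Λ.powerset, ∑ Z ∈ Λ.powerset with x ∈ Z ∧ y ∈ Z,
          if nbhd G Λ X n = Z then ENNReal.ofReal ((Z.card : ℝ) ^ k) *
            (X.card * supNorm Ψ Λ X * ENNReal.ofReal (η n)) else 0 := by
        simp only [Finset.mul_sum, mul_ite, mul_zero]
        exact Finset.sum_comm.trans
          ((Finset.sum_congr rfl fun X _ => Finset.sum_comm).trans Finset.sum_comm)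
    _ ≤ ∑ n ∈ Finset.range N, ∑ X ∈ Λ.powerset with x ∈ nbhd G Λ X n ∧ y ∈ nbhd G Λ X n,
          ENNReal.ofReal (η n) * ENNReal.ofReal ((κ * (1 + n) ^ d) ^ k.natAbs) *
            (ENNReal.ofReal ((X.card : ℝ) ^ (k + 1)) * supNorm Ψ Λ X) := by
        refine Finset.sum_le_sum fun n _ => ?_
        rw [Finset.sum_filter]
        refine Finset.sum_le_sum fun X hX => ?_
        rw [Finset.mem_powerset] at hX
        rw [Finset.sum_ite_eq]
        simp only [Finset.mem_filter, Finset.mem_powerset, nbhd_subset, true_and]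
        split_ifs with h
        · have hne : X.Nonempty := by
            obtain ⟨-, x', hx', -⟩ := mem_nbhd.1 h.1
            exact ⟨x', hx'⟩
          have hcard := hne.card_pos
          have hcard' : (0 : ℝ) < X.card := by exact_mod_cast hcard
          have hb : 1 ≤ κ * (1 + n : ℝ) ^ d :=
            one_le_mul_of_one_le_of_one_le hκ1
              (one_le_pow₀ (by linarith [Nat.cast_nonneg (α := ℝ) n]))
          have h1 := card_zpow_le hcard (Finset.card_le_card (subset_nbhd (G := G) hX n)) hb
            (card_nbhd_le hκ Λ X n) k
          calc ENNReal.ofReal (((nbhd G Λ X n).card : ℝ) ^ k) *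
                (X.card * supNorm Ψ Λ X * ENNReal.ofReal (η n))
              ≤ ENNReal.ofReal ((X.card : ℝ) ^ k * (κ * (1 + n) ^ d) ^ k.natAbs) *
                (X.card * supNorm Ψ Λ X * ENNReal.ofReal (η n)) := by
                gcongr
            _ = _ := by
                rw [zpow_add₀ hcard'.ne', zpow_one, ENNReal.ofReal_mul (by positivity),
                  ENNReal.ofReal_mul (by positivity), ENNReal.ofReal_natCast]
                ring
        · exact zero_le
    _ ≤ _ := by
        refine Finset.sum_le_sum fun n _ => ?_
        rw [← Finset.mul_sum]
        gcongr
        exact sum_nbhd_le Λ x y n _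

/-- The averaged interaction is as local as `Ψ`, up to one power of the size of the supports. -/
theorem memBS_averagedTerms {W : ℝ → ℝ} {Φ Ψ : Terms q} (hG : G.Connected) {η : ℕ → ℝ} {d : ℕ}
    (hd : IsDimensional G d) (hΦ : IsInteraction Φ) (hη0 : ∀ n, 0 ≤ η n)
    (hηp : ∀ p : ℕ, ∃ C, 0 ≤ C ∧ ∀ n : ℕ, η n * (1 + n) ^ p ≤ C)
    (hη : ∀ Λ, ∀ s ∈ Set.Icc (0 : ℝ) 1, ∀ X ⊆ Λ, X.Nonempty → ∀ n,
      ‖layer G W (Φ Λ s) Λ (Ψ Λ s X) n‖ ≤ X.card * ‖Ψ Λ s X‖ * η n)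
    {k : ℤ} (hΨ : MemBS G d (k + 1) Ψ) : MemBS G d k (averagedTerms G W Φ Ψ) := by
  obtain ⟨κ, hκ1, hκ⟩ := exists_ball_le hd
  obtain ⟨ζ, hζ, hΨi, hlt⟩ := hΨ
  set A := (interactionNorm G d ζ (k + 1) Ψ).toReal with hA
  have hA0 : 0 ≤ A := ENNReal.toReal_nonneg
  have hΨp : ∀ Λ x y, pairSum (k + 1) Ψ Λ x y ≤
      ENNReal.ofReal (A * decay d ζ (G.dist x y)) := by
    intro Λ x y
    rw [ENNReal.ofReal_mul hA0, hA, ENNReal.ofReal_toReal hlt.ne]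
    exact (interactionNorm_le_iff hζ (k + 1) hΨi _).1 le_rfl Λ x y
  have hκ0 : 0 ≤ κ := zero_le_one.trans hκ1
  refine memBS_of_pairSum_le (isInteraction_averagedTerms W hΦ hΨi) fun p => ?_
  obtain ⟨c, hc0, hc⟩ := exists_decay_mul_pow_le hζ d p
  obtain ⟨E, hE0, hE⟩ := hηp (d * (k.natAbs + 2) + p + 2)
  have hsum : Summable fun n : ℕ => (((1 : ℝ) + n) ^ 2)⁻¹ := by
    have := (summable_nat_add_iff 1).2 (Real.summable_nat_pow_inv.2 one_lt_two)
    refine this.congr fun n => ?_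
    push_cast
    rw [add_comm]
  set S := ∑' n : ℕ, (((1 : ℝ) + n) ^ 2)⁻¹
  have hS0 : 0 ≤ S := tsum_nonneg fun n => by positivity
  refine ⟨E * κ ^ (k.natAbs + 2) * A * c * 2 ^ p * S, by positivity, fun Λ x y => ?_⟩
  set R : ℝ := ((1 + G.dist x y : ℝ) ^ p)⁻¹ with hR
  have hR0 : 0 ≤ R := by positivity
  -- points within `n` of `x` and `y` are at distance at least `dist x y - 2 n`
  have hdec : ∀ n : ℕ, ∀ x' y', G.dist x x' ≤ n → G.dist y y' ≤ n →
      A * decay d ζ (G.dist x' y') ≤ A * (c * (2 ^ p * (1 + n) ^ p) * R) := by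
    intro n x' y' hx' hy'
    have h1 : G.dist x y ≤ n + G.dist x' y' + n := by
      have h2 : G.dist x y ≤ G.dist x x' + G.dist x' y := hG.dist_triangle
      have h3 : G.dist x' y ≤ G.dist x' y' + G.dist y' y := hG.dist_triangle
      rw [SimpleGraph.dist_comm (u := y')] at h3
      omega
    have h1' : (G.dist x y : ℝ) ≤ n + G.dist x' y' + n := by exact_mod_cast h1
    set r : ℝ := (G.dist x' y' : ℝ) with hr
    have hr0 : 0 ≤ r := Nat.cast_nonneg _
    have hn0 : (0 : ℝ) ≤ n := Nat.cast_nonneg n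
    have h2 : (1 + G.dist x y : ℝ) ^ p ≤ (1 + r) ^ p * (2 ^ p * (1 + n) ^ p) := by
      rw [← mul_pow, ← mul_pow]
      gcongr
      nlinarith [mul_nonneg hr0 hn0]
    gcongr
    rw [hR, ← div_eq_mul_inv, le_div_iff₀ (by positivity)]
    calc decay d ζ r * (1 + G.dist x y : ℝ) ^ p
        ≤ decay d ζ r * ((1 + r) ^ p * (2 ^ p * (1 + n) ^ p)) := by
          have := (decay_pos hζ d hr0).le
          gcongr
      _ = decay d ζ r * (1 + r) ^ p * (2 ^ p * (1 + n) ^ p) := by ring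
      _ ≤ _ := by gcongr; exact hc r hr0
  have hterm : ∀ n : ℕ, ENNReal.ofReal (η n) * ENNReal.ofReal ((κ * (1 + n) ^ d) ^ k.natAbs) *
      (∑ x' ∈ Λ with G.dist x x' ≤ n, ∑ y' ∈ Λ with G.dist y y' ≤ n,
        pairSum (k + 1) Ψ Λ x' y') ≤
      ENNReal.ofReal (E * κ ^ (k.natAbs + 2) * A * c * 2 ^ p * R * (((1 : ℝ) + n) ^ 2)⁻¹) := by
    intro n
    have hn0 : (0 : ℝ) ≤ n := Nat.cast_nonneg n
    set D := A * (c * (2 ^ p * (1 + n : ℝ) ^ p) * R) with hD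
    have hD0 : 0 ≤ D := by positivity
    have hball : ∀ z : Γ, ((({z' ∈ Λ | G.dist z z' ≤ n} : Finset Γ).card : ℕ) : ℝ≥0∞) ≤
        ENNReal.ofReal (κ * (1 + n) ^ d) := fun z => by
      rw [← ENNReal.ofReal_natCast]
      exact ENNReal.ofReal_le_ofReal (hκ z n _ fun z' hz' => (Finset.mem_filter.1 hz').2)
    have h1 : (∑ x' ∈ Λ with G.dist x x' ≤ n, ∑ y' ∈ Λ with G.dist y y' ≤ n,
        pairSum (k + 1) Ψ Λ x' y') ≤
        ENNReal.ofReal (κ * (1 + n) ^ d) * (ENNReal.ofReal (κ * (1 + n) ^ d) *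
          ENNReal.ofReal D) := by
      calc _ ≤ ∑ x' ∈ Λ with G.dist x x' ≤ n, ∑ y' ∈ Λ with G.dist y y' ≤ n,
            ENNReal.ofReal D := by
            refine Finset.sum_le_sum fun x' hx' => Finset.sum_le_sum fun y' hy' => ?_
            exact (hΨp Λ x' y').trans (ENNReal.ofReal_le_ofReal
              (hdec n x' y' (Finset.mem_filter.1 hx').2 (Finset.mem_filter.1 hy').2))
        _ ≤ _ := by
            simp only [Finset.sum_const, nsmul_eq_mul]
            gcongr
            · exact hball x
            · exact hball y
    refine (mul_le_mul_right h1 _).trans ?_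
    have hηn := hη0 n
    rw [← ENNReal.ofReal_mul hηn, ← ENNReal.ofReal_mul (by positivity),
      ← ENNReal.ofReal_mul (by positivity), ← ENNReal.ofReal_mul (by positivity)]
    refine ENNReal.ofReal_le_ofReal ?_
    rw [← div_eq_mul_inv, le_div_iff₀ (by positivity)]
    calc _ = (η n * (1 + n) ^ (d * (k.natAbs + 2) + p + 2)) *
          (κ ^ (k.natAbs + 2) * A * c * 2 ^ p * R) := by
          rw [hD]; ring
      _ ≤ E * (κ ^ (k.natAbs + 2) * A * c * 2 ^ p * R) := by gcongr; exact hE n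
      _ = _ := by ring
  refine (pairSum_averagedTerms_le hκ1 hκ hη k Λ x y).trans
    ((Finset.sum_le_sum fun n _ => hterm n).trans ?_)
  rw [← ENNReal.ofReal_sum_of_nonneg fun n _ => by positivity, ← Finset.mul_sum]
  refine ENNReal.ofReal_le_ofReal ?_
  calc _ ≤ E * κ ^ (k.natAbs + 2) * A * c * 2 ^ p * R * S := by
        gcongr
        exact hsum.sum_le_tsum _ fun n _ => by positivity
    _ = _ := by ring

/-- The layers of the time averages decay rapidly, uniformly in the volume, the time and the
support, if the Hamiltonian is exponentially local. -/
theorem exists_norm_layer_le {d : ℕ} (hG : G.Connected) (hd : IsDimensional G d) {Φ : Terms q}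
    (hΦ : MemBE G d 0 Φ) {γ : ℝ} {W : ℝ → ℝ} (hW : IsWeight γ W) :
    ∃ η : ℕ → ℝ, (∀ n, 0 ≤ η n) ∧ (∀ p : ℕ, ∃ C, 0 ≤ C ∧ ∀ n : ℕ, η n * (1 + n) ^ p ≤ C) ∧
      ∀ (Ψ : Terms q) Λ, ∀ s ∈ Set.Icc (0 : ℝ) 1, ∀ X ⊆ Λ, X.Nonempty → ∀ n,
        ‖layer G W (Φ Λ s) Λ (Ψ Λ s X) n‖ ≤ X.card * ‖Ψ Λ s X‖ * η n := by
  obtain ⟨μ, hμ, hΦi, hlt⟩ := hΦ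
  have hζ := isFastDecaying_exp hμ
  set A := (interactionNorm G d (fun r => Real.exp (-μ * r)) 0 Φ).toReal with hA
  have hA0 : 0 ≤ A := ENNReal.toReal_nonneg
  have hν : 0 < μ / 2 := half_pos hμ
  obtain ⟨S, hS0, hS⟩ := exists_sum_exp_le hd hν
  have hf : ∀ Λ, ∀ s ∈ Set.Icc (0 : ℝ) 1, ∀ x z,
      ∑ Z ∈ Λ.powerset with x ∈ Z ∧ z ∈ Z, ‖Φ Λ s Z‖ ≤
        (A + 1) * Real.exp (-(2 * (μ / 2)) * G.dist x z) := by
    intro Λ s hs x z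
    have h1 := (interactionNorm_le_iff (G := G) (d := d) hζ 0 hΦi _).1 le_rfl Λ x z
    rw [← ENNReal.ofReal_toReal hlt.ne, ← hA, ← ENNReal.ofReal_mul hA0] at h1
    have h2 : ENNReal.ofReal (∑ Z ∈ Λ.powerset with x ∈ Z ∧ z ∈ Z, ‖Φ Λ s Z‖) ≤
        pairSum 0 Φ Λ x z := by
      rw [ENNReal.ofReal_sum_of_nonneg fun _ _ => norm_nonneg _]
      refine Finset.sum_le_sum fun Z _ => ?_
      rw [zpow_zero, ENNReal.ofReal_one, one_mul, ofReal_norm]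
      exact enorm_le_supNorm Φ Λ Z hs
    have hr : (0 : ℝ) ≤ G.dist x z := Nat.cast_nonneg _
    have h3 := (ENNReal.ofReal_le_ofReal_iff (mul_nonneg hA0 (decay_pos hζ d hr).le)).1
      (h2.trans h1)
    refine h3.trans ?_
    rw [mul_div_cancel₀ _ two_ne_zero]
    have h4 := decay_le hζ d hr
    have := (decay_pos hζ d hr).le
    gcongr
    linarith
  refine ⟨tailWeight W (4 * ((A + 1) * S)) (μ / 2), tailWeight_nonneg _ _ _,
    hW.exists_tailWeight_le (by positivity) hν, fun Ψ Λ s hs X hX hne n => ?_⟩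
  exact norm_layer_le hW.integrable (hΦi.selfAdjoint Λ s hs) hG hν (by positivity) hS0
    (hf Λ s hs) (fun x => hS x Λ) hX hne _ n

end AveragedInteraction

/-! ### The time derivative of the Hamiltonian -/

section Derivative

variable {Γ : Type*} [DecidableEq Γ] {q : Γ → ℕ} {G : SimpleGraph Γ}

theorem isAssociated_timeDeriv_one {Φ : Terms q} (h : ∀ Λ X,
    DifferentiableOn ℝ (fun s => Φ Λ s X) (Set.Icc (0 : ℝ) 1)) :
    IsAssociated (timeDeriv 1 Φ) (opDeriv (hamiltonian Φ)) := by
  intro Λ s hs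
  have hu : UniqueDiffWithinAt ℝ (Set.Icc (0 : ℝ) 1) s := uniqueDiffOn_Icc zero_lt_one s hs
  have h1 : HasDerivWithinAt (fun u => hamiltonian Φ Λ u) (hamiltonian (timeDeriv 1 Φ) Λ s)
      (Set.Icc (0 : ℝ) 1) s := by
    simp only [hamiltonian]
    refine HasDerivWithinAt.fun_sum fun X _ => ?_
    have h2 := (h Λ X.1 s hs).hasDerivWithinAt
    simp only [timeDeriv, iteratedDerivWithin_one]
    exact ((embedCLM (Finset.mem_powerset.1 X.2)).restrictScalars
      ℝ).hasFDerivAt.comp_hasDerivWithinAt s h2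
  exact h1.derivWithin hu

theorem MemBE.memBS {d : ℕ} {n : ℤ} {Φ : Terms q} (h : MemBE G d n Φ) : MemBS G d n Φ :=
  let ⟨_, hμ, hΦ⟩ := h
  ⟨_, isFastDecaying_exp hμ, hΦ⟩

end Derivative

end SpinSystem

theorem lemma5 {Γ : Type*} [DecidableEq Γ] [Countable Γ] (G : SimpleGraph Γ) (hG : G.Connected)
    (d : ℕ) (hd : IsDimensional G d)
    (q : Γ → ℕ) (hq : ∀ x, 0 < q x) (hq_bdd : BddAbove (Set.range q))
    (m : ℕ) (hm : 1 ≤ m) (Φ : Terms q) (hΦ : IsSmoothLocal G d m Φ)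
    (γ : ℝ) (hγ : 0 < γ) (W : ℝ → ℝ) (hW : IsWeight γ W) :
    (∀ (k : ℤ) (B : OpFamily q),
        MemLS G d (k + 1) B → MemLS G d k (spectralMap W (hamiltonian Φ) B)) ∧
      (∀ B : OpFamily q,
        MemLSInfty G d B → MemLSInfty G d (spectralMap W (hamiltonian Φ) B)) ∧
      MemLSInfty G d (spectralFlowGenerator W (hamiltonian Φ)) := by
  have hE : MemBE G d 0 Φ := by
    have := hΦ.memB 0 (Nat.zero_le _) 0
    have e : timeDeriv 0 Φ = Φ := by
      funext Λ s X
      simp [timeDeriv]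
    rwa [e] at this
  obtain ⟨η, hη0, hηp, hη⟩ := exists_norm_layer_le hG hd hE hW
  have hint := hΦ.isInteraction
  have key : ∀ (k : ℤ) (Ψ : Terms q), MemBS G d (k + 1) Ψ →
      MemBS G d k (averagedTerms G W Φ Ψ) := fun k Ψ hΨ =>
    memBS_averagedTerms hG hd hint hη0 hηp (hη Ψ) hΨ
  have infty : ∀ B : OpFamily q,
      MemLSInfty G d B → MemLSInfty G d (spectralMap W (hamiltonian Φ) B) := by
    rintro B ⟨Ψ, hΨ, hB⟩
    refine ⟨_, fun n => key n Ψ ?_, isAssociated_averagedTerms hW.integrable hint hB⟩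
    exact_mod_cast hΨ (n + 1)
  refine ⟨?_, infty, infty _ ⟨timeDeriv 1 Φ, fun n => ?_, isAssociated_timeDeriv_one fun Λ X => ?_⟩⟩
  · rintro k B ⟨Ψ, hΨ, hB⟩
    exact ⟨_, key k Ψ hΨ, isAssociated_averagedTerms hW.integrable hint hB⟩
  · exact (hΦ.memB 1 (by omega) n).memBS
  · refine (hΦ.contDiffOn Λ X).differentiableOn ?_
    have : d + m ≠ 0 := by omega
    exact_mod_cast this
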